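/- Let $(X,d,\mu)$ be a metric space with a measure $\mu$ for which all Borel sets are measurable, such that every closed ball $B(x,s)$ with $x\in X$, $s>0$ satisfies $0<\mu(B(x,s))<\infty$. Fix $r>0$ and assume the following. (i) For every $s\ge r$, $X$ is $s$-doubling: there is $\gamma\in[1,\infty)$ such that $\mu(B(x,2s))\le\gamma\,\mu(B(x,s))$ for all $x\in X$. (ii) $X$ has the Vitali covering property: if $A\subset X$ is any subset and $\mathcal B$ is a family of closed balls centered in $A$ with uniformly bounded positive radii such that, for every $x\in A$, the set $\{s>0 : B(x,s)\in\mathcal B\}$ is non-empty with infimum $0$, then there is a countable subfamily $\mathcal B'\subset\mathcal B$ of pairwise disjoint balls with $\mu(A\setminus\bigcup\mathcal B')=0$ ($\mu$ being extended to arbitrary sets as an outer measure). (iii) For each $x\in X$, $\mu(B(x,r)\,\triangle\,B(y,r))\to0$ as $y\to x$. For a measurable function $f:X\to\mathbb R$ and $t\geq 0$ put $f^*(t)=\inf\{s\in[0,\infty) : \mu(\{x : |f(x)|>s\})\le t\}$ (with $\inf\emptyset=\infty$), and for $t>0$ put $f^{**}(t)=\frac1t\int_0^t f^*(s)\,ds$.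 Let $p\in(1,\infty)$ and $q\in[1,\infty]$, and put $$\|f\|_{p,q}=\Big(\int_0^\infty t^{q/p-1}f^*(t)^q\,dt\Big)^{1/q}\ \ (q<\infty),\qquad \|f\|_{p,\infty}=\sup_{t>0}t^{1/p}f^*(t),$$ and let $\|f\|_{(p,q)}$ be defined by the same formulas with $f^{**}$ in place of $f^*$. The Lorentz space $L^{p,q}(X)$ is the space of measurable $f:X\to\mathbb R$ with $\|f\|_{p,q}<\infty$ (functions equal a.e. being identified), equipped with either the (quasi-)norm $\|\cdot\|_{p,q}$ or the norm $\|\cdot\|_{(p,q)}$. The averaging operator is $$A_rf(x)=\frac1{\mu(B(x,r))}\int_{B(x,r)}f\,d\mu .$$ Then $A_r$ maps $L^{p,q}(X)$ into $L^{p,q}(X)$, and, for each of the two choices $\|\cdot\|_{p,q}$ and $\|\cdot\|_{(p,q)}$, the operator $A_r:L^{p,q}(X)\to L^{p,q}(X)$ is compact (that is, the image of every bounded sequence has a subsequence converging in $L^{p,q}(X)$) if and only if $X$ is bounded. -/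

import Mathlib

open MeasureTheory Set Filter Topology
open scoped NNReal ENNReal

noncomputable section

namespace AvgOp

variable {X : Type*}

section Space

variable [MetricSpace X] [MeasurableSpace X]

/-- `X` is `s`-doubling: there is a finite `γ ≥ 1` with `μ(B(x,2s)) ≤ γ μ(B(x,s))` for all `x`,
where `B(x,s)` is the closed ball. -/
def IsDoublingAt (μ : Measure X) (s : ℝ) : Prop :=
  ∃ γ : ℝ≥0, 1 ≤ γ ∧
    ∀ x : X, μ (Metric.closedBall x (2 * s)) ≤ (γ : ℝ≥0∞) * μ (Metric.closedBall x s)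

/-- The Vitali covering property. `A` is an arbitrary subset (so `μ` is applied as an outer
measure to `A \ ⋃₀ 𝓑'`) and `𝓑` is a family of closed balls centered in `A` with uniformly bounded
radii. `IsGLB _ 0` forces the set of radii to be non-empty, as it would fail for the empty set. -/
def VitaliCoveringProperty (μ : Measure X) : Prop :=
  ∀ (A : Set X) (𝓑 : Set (Set X)),
    (∃ R : ℝ, ∀ b ∈ 𝓑, ∃ x ∈ A, ∃ s : ℝ, 0 < s ∧ s ≤ R ∧ b = Metric.closedBall x s) →
    (∀ x ∈ A, IsGLB {s : ℝ | 0 < s ∧ Metric.closedBall x s ∈ 𝓑} 0) →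
    ∃ 𝓑' : Set (Set X), 𝓑' ⊆ 𝓑 ∧ 𝓑'.Countable ∧ 𝓑'.PairwiseDisjoint id ∧
      μ (A \ ⋃₀ 𝓑') = 0

/-- The averaging operator `A_r f (x) = μ(B(x,r))⁻¹ ∫_{B(x,r)} f dμ`. -/
def averaging (μ : Measure X) (r : ℝ) (f : X → ℝ) : X → ℝ :=
  fun x => (μ.real (Metric.closedBall x r))⁻¹ * ∫ y in Metric.closedBall x r, f y ∂μ

end Space

section Lorentz

variable [MeasurableSpace X]

/-- The distribution function `μ_f(s) = μ {x | |f x| > s}`. -/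
def distribution (μ : Measure X) (f : X → ℝ) (s : ℝ≥0) : ℝ≥0∞ :=
  μ {x | (s : ℝ) < |f x|}

/-- The rearrangement `f*(t) = inf {s ∈ [0,∞) | μ_f(s) ≤ t}`, with `inf ∅ = ∞`; only the values at
`t ≥ 0` matter. -/
def rearrangement (μ : Measure X) (f : X → ℝ) (t : ℝ) : ℝ≥0∞ :=
  ⨅ (s : ℝ≥0) (_ : distribution μ f s ≤ ENNReal.ofReal t), (s : ℝ≥0∞)

/-- The maximal function `f**(t) = t⁻¹ ∫_0^t f*(s) ds` of the rearrangement, for `t > 0`. -/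
def maximalRearrangement (μ : Measure X) (f : X → ℝ) (t : ℝ) : ℝ≥0∞ :=
  (ENNReal.ofReal t)⁻¹ * ∫⁻ s in Ioc (0 : ℝ) t, rearrangement μ f s

/-- For `h : (0,∞) → [0,∞]`: the quantity `(∫_0^∞ t^(q/p-1) h(t)^q dt)^(1/q)` if `q < ∞`, and
`sup_{t>0} t^(1/p) h(t)` if `q = ∞`. -/
def weightedNorm (p : ℝ) (q : ℝ≥0∞) (h : ℝ → ℝ≥0∞) : ℝ≥0∞ :=
  if q = ⊤ then ⨆ t ∈ Ioi (0 : ℝ), ENNReal.ofReal (t ^ (1 / p)) * h t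
  else (∫⁻ t in Ioi (0 : ℝ),
    ENNReal.ofReal (t ^ (q.toReal / p - 1)) * h t ^ q.toReal) ^ (1 / q.toReal)

/-- `‖f‖_{p,q}`, computed from `f*`. -/
def lorentzNorm (μ : Measure X) (p : ℝ) (q : ℝ≥0∞) (f : X → ℝ) : ℝ≥0∞ :=
  weightedNorm p q (rearrangement μ f)

/-- `‖f‖_{(p,q)}`, computed from `f**`. -/
def lorentzNormMax (μ : Measure X) (p : ℝ) (q : ℝ≥0∞) (f : X → ℝ) : ℝ≥0∞ :=
  weightedNorm p q (maximalRearrangement μ f)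

/-- The Lorentz space `L^{p,q}(X)`: the measurable functions with `‖f‖_{p,q} < ∞`. (Functions that
agree a.e. are at distance zero for both norms.) -/
def lorentzSpace (μ : Measure X) (p : ℝ) (q : ℝ≥0∞) : Set (X → ℝ) :=
  {f | Measurable f ∧ lorentzNorm μ p q f < ⊤}

end Lorentz

/-- An operator `T` on a space `E` of functions with (quasi-)norm `N` is compact: it maps `E` into
`E`, and the image of every bounded sequence has a subsequence that converges in `E`. -/
def IsCompactOn (E : Set (X → ℝ)) (N : (X → ℝ) → ℝ≥0∞) (T : (X → ℝ) → (X → ℝ)) : Prop :=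
  MapsTo T E E ∧
    ∀ f : ℕ → X → ℝ, (∀ n, f n ∈ E) → (∃ C : ℝ≥0, ∀ n, N (f n) ≤ C) →
      ∃ g ∈ E, ∃ φ : ℕ → ℕ, StrictMono φ ∧
        Tendsto (fun n => N (T (f (φ n)) - g)) atTop (𝓝 0)

end AvgOp

end

/-!
The two norms are equivalent, uniformly in `q`: clearly `f* ≤ f**`, and since `f*` is
non-increasing, a dyadic decomposition of `(0, t]` gives `f**(t) ≤ ∑ 2^(-k-1) f*(2^(-k-1) t)`,
so that Minkowski's inequality and the scaling of the weighted norm give Hardy's inequality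
(`lorentzNormMax_le`), the series converging because `p > 1`. It therefore suffices to study the
quasi-norm built from `f*`.
A consequence used throughout is the uniform absolute continuity
`∫_E |f| ≤ C μ(E)^(1-1/p) ‖f‖_{p,q}` (`setLIntegral_le_lorentzNorm`).

Boundedness. The Vitali property forces `X` to be separable, so Tonelli's theorem applies to the
averaging kernel, and doubling at scale `r` shows that averaging is bounded on `L^1`. Truncating `f`
at height `f*(t)` then yields `(A_r f)*(t) ≤ (1 + γ) f**(t)` (`rearrangement_averaging_le`).

Bounded spaces. Iterated doubling bounds the measures of the balls of radius `r` from below, so the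
averages of a bounded sequence are uniformly bounded; by the continuity of `x ↦ B(x, r)` in measure
and the uniform absolute continuity they are equicontinuous (`exists_modulus_averaging`). A diagonal
argument on a countable dense set gives a pointwise convergent subsequence, and convergence in norm
follows from bounded convergence on a space of finite measure (`tendsto_lorentzNorm_of_tendsto`).

Unbounded spaces. For points `x_n` at mutual distances greater than `6 r`, the functions
`μ(B(x_n, r))^(-1/p) 1_{B(x_n, 2r)}` are bounded by doubling. Their averages have disjoint supports
and equal `μ(B(x_n, r))^(-1/p)` on `B(x_n, r)`, hence stay uniformly apart
(`isBounded_of_isCompactOn_averaging`).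
-/

namespace AvgOp

/-! ### The weighted norms on the half-line -/

lemma weightedNorm_top (p : ℝ) (h : ℝ → ℝ≥0∞) :
    weightedNorm p ⊤ h = ⨆ t ∈ Ioi (0 : ℝ), ENNReal.ofReal (t ^ (1 / p)) * h t := if_pos rfl

lemma one_le_toReal_of_one_le {q : ℝ≥0∞} (hq : 1 ≤ q) (hq' : q ≠ ⊤) : 1 ≤ q.toReal := by
  simpa using (ENNReal.toReal_le_toReal ENNReal.one_ne_top hq').2 hq

/-- For finite `q` the weighted norm is an ordinary `L^q` norm on `(0, ∞)`, the weight being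
distributed as `t^(1/p - 1/q)` on the function itself. -/
lemma weightedNorm_eq_eLpNorm' {p : ℝ} {q : ℝ≥0∞} (hq : 1 ≤ q) (hq' : q ≠ ⊤)
    (h : ℝ → ℝ≥0∞) :
    weightedNorm p q h =
      eLpNorm' (fun t : ℝ => ENNReal.ofReal (t ^ (1 / p - 1 / q.toReal)) * h t) q.toReal
        (volume.restrict (Ioi 0)) := by
  have hq1 := one_le_toReal_of_one_le hq hq'
  have hq0 : q.toReal ≠ 0 := by linarith
  rw [weightedNorm, if_neg hq', eLpNorm']
  congr 1
  refine setLIntegral_congr_fun measurableSet_Ioi fun t ht => ?_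
  have ht : (0 : ℝ) < t := ht
  simp only [enorm_eq_self]
  rw [ENNReal.mul_rpow_of_nonneg _ _ (by linarith),
    ENNReal.ofReal_rpow_of_nonneg (by positivity) (by linarith), ← Real.rpow_mul ht.le]
  congr 3
  field_simp

lemma weightedNorm_mono {p : ℝ} {q : ℝ≥0∞} {h k : ℝ → ℝ≥0∞} (hk : ∀ t, 0 < t → h t ≤ k t) :
    weightedNorm p q h ≤ weightedNorm p q k := by
  unfold weightedNorm
  split_ifs with hq
  · gcongr with t ht
    exact hk t ht
  · gcongr ?_ ^ _
    refine setLIntegral_mono' measurableSet_Ioi fun t ht => ?_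
    gcongr
    exact hk t ht

lemma weightedNorm_const_mul {p : ℝ} {q : ℝ≥0∞} (hq : 1 ≤ q) {h : ℝ → ℝ≥0∞} (hh : Measurable h)
    (c : ℝ≥0∞) : weightedNorm p q (fun t => c * h t) = c * weightedNorm p q h := by
  unfold weightedNorm
  split_ifs with hq'
  · simp_rw [ENNReal.mul_iSup]
    exact iSup_congr fun t => iSup_congr fun _ => mul_left_comm _ _ _
  · have hq1 := one_le_toReal_of_one_le hq hq'
    have (t : ℝ) : ENNReal.ofReal (t ^ (q.toReal / p - 1)) * (c * h t) ^ q.toReal =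
        c ^ q.toReal * (ENNReal.ofReal (t ^ (q.toReal / p - 1)) * h t ^ q.toReal) := by
      rw [ENNReal.mul_rpow_of_nonneg _ _ (by linarith)]
      ring
    simp_rw [this]
    rw [lintegral_const_mul _ (by fun_prop), ENNReal.mul_rpow_of_nonneg _ _ (by positivity),
      ← ENNReal.rpow_mul, mul_one_div_cancel (by linarith), ENNReal.rpow_one]

/-- Minkowski's inequality for series. -/
lemma weightedNorm_tsum_le {p : ℝ} {q : ℝ≥0∞} (hq : 1 ≤ q) {h : ℕ → ℝ → ℝ≥0∞}
    (hh : ∀ k, Measurable (h k)) :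
    weightedNorm p q (fun t => ∑' k, h k t) ≤ ∑' k, weightedNorm p q (h k) := by
  by_cases hq' : q = ⊤
  · subst hq'
    simp_rw [weightedNorm_top]
    refine iSup₂_le fun t ht => ?_
    rw [← ENNReal.tsum_mul_left]
    exact ENNReal.tsum_le_tsum fun k =>
      le_iSup₂ (f := fun t (_ : t ∈ Ioi (0 : ℝ)) => ENNReal.ofReal (t ^ (1 / p)) * h k t) t ht
  have hq1 := one_le_toReal_of_one_le hq hq'
  simp_rw [weightedNorm_eq_eLpNorm' hq hq']
  set F : ℕ → ℝ → ℝ≥0∞ := fun k t => ENNReal.ofReal (t ^ (1 / p - 1 / q.toReal)) * h k t with hF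
  have hFm : ∀ k, Measurable (F k) := fun k => by have := hh k; fun_prop
  have hsum : ∀ t, ENNReal.ofReal (t ^ (1 / p - 1 / q.toReal)) * ∑' k, h k t
      = ⨆ n : ℕ, ∑ k ∈ Finset.range n, F k t := fun t => by
    rw [← ENNReal.tsum_mul_left, ENNReal.tsum_eq_iSup_nat]
  simp_rw [hsum]
  have hmono : ∀ t, Monotone fun n : ℕ => ∑ k ∈ Finset.range n, F k t := fun t m n hmn =>
    Finset.sum_le_sum_of_subset (Finset.range_mono hmn)
  have hlim : eLpNorm' (fun t => ⨆ n : ℕ, ∑ k ∈ Finset.range n, F k t) q.toReal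
      (volume.restrict (Ioi 0)) = ⨆ n : ℕ, eLpNorm' (∑ k ∈ Finset.range n, F k) q.toReal
      (volume.restrict (Ioi 0)) := by
    have hiso : ∀ (a : ℝ) (ha : 0 < a) (u : ℕ → ℝ≥0∞), (⨆ n, u n) ^ a = ⨆ n, u n ^ a :=
      fun a ha u => (ENNReal.orderIsoRpow a ha).map_iSup u
    simp only [eLpNorm', enorm_eq_self, Finset.sum_apply]
    rw [← hiso _ (by positivity), ← lintegral_iSup]
    · simp_rw [hiso _ (by linarith : 0 < q.toReal)]
    · intro n
      have := fun k => hFm k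
      fun_prop
    · intro m n hmn t
      exact ENNReal.rpow_le_rpow (hmono t hmn) (by linarith)
  rw [hlim]
  exact iSup_le fun n => (eLpNorm'_sum_le (fun k _ => (hFm k).aestronglyMeasurable) hq1).trans
    (ENNReal.sum_le_tsum _)

lemma lintegral_Ioi_comp_mul_left {a : ℝ} (ha : 0 < a) (h : ℝ → ℝ≥0∞) :
    ∫⁻ t in Ioi (0 : ℝ), h (a * t) = (ENNReal.ofReal a)⁻¹ * ∫⁻ t in Ioi (0 : ℝ), h t := by
  have hemb : MeasurableEmbedding (fun t : ℝ => a * t) :=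
    (Homeomorph.mulLeft₀ a ha.ne').measurableEmbedding
  have hpre : (fun t : ℝ => a * t) ⁻¹' Ioi 0 = Ioi 0 := by
    ext t; simp [ha]
  have hvol : Measure.map (fun t : ℝ => a * t) volume = (ENNReal.ofReal a)⁻¹ • volume := by
    rw [Real.map_volume_mul_left ha.ne', abs_of_pos (by positivity), ENNReal.ofReal_inv_of_pos ha]
  have := hemb.lintegral_map (μ := volume.restrict (Ioi 0)) h
  rw [← this]
  nth_rw 1 [← hpre]
  rw [← hemb.restrict_map, hvol, Measure.restrict_smul, lintegral_smul_measure, smul_eq_mul]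

/-- Scaling of the weighted norm under dilations. -/
lemma weightedNorm_comp_mul_left {p : ℝ} {q : ℝ≥0∞} (hq : 1 ≤ q) {a : ℝ} (ha : 0 < a)
    (h : ℝ → ℝ≥0∞) :
    weightedNorm p q (fun t => h (a * t)) =
      ENNReal.ofReal (a ^ (-(1 / p))) * weightedNorm p q h := by
  by_cases hq' : q = ⊤
  · subst hq'
    simp_rw [weightedNorm_top, ENNReal.mul_iSup]
    refine le_antisymm (iSup₂_le fun t ht => ?_) (iSup₂_le fun t ht => ?_)
    · have ht : (0 : ℝ) < t := ht
      refine le_iSup₂_of_le (a * t) (mul_pos ha ht) ?_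
      rw [← mul_assoc, ← ENNReal.ofReal_mul (by positivity), Real.mul_rpow ha.le ht.le,
        ← mul_assoc, ← Real.rpow_add ha]
      simp
    · have ht : (0 : ℝ) < t := ht
      refine le_iSup₂_of_le (a⁻¹ * t) (mul_pos (inv_pos.2 ha) ht) ?_
      rw [← mul_assoc, ← ENNReal.ofReal_mul (by positivity),
        Real.mul_rpow (by positivity) ht.le, mul_inv_cancel_left₀ ha.ne', Real.rpow_neg ha.le,
        Real.inv_rpow ha.le]
  have hq1 := one_le_toReal_of_one_le hq hq'
  rw [weightedNorm, weightedNorm, if_neg hq', if_neg hq']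
  set e := q.toReal / p - 1 with he
  have key : ∫⁻ t in Ioi (0 : ℝ), ENNReal.ofReal (t ^ e) * h (a * t) ^ q.toReal =
      ENNReal.ofReal (a ^ (-(q.toReal / p))) *
        ∫⁻ t in Ioi (0 : ℝ), ENNReal.ofReal (t ^ e) * h t ^ q.toReal := by
    have h1 : ∫⁻ t in Ioi (0 : ℝ), ENNReal.ofReal (t ^ e) * h (a * t) ^ q.toReal =
        ∫⁻ t in Ioi (0 : ℝ), ENNReal.ofReal (a ^ (-e)) *
          (ENNReal.ofReal ((a * t) ^ e) * h (a * t) ^ q.toReal) := by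
      refine setLIntegral_congr_fun measurableSet_Ioi fun t ht => ?_
      have ht : (0 : ℝ) < t := ht
      rw [← mul_assoc, ← ENNReal.ofReal_mul (by positivity), Real.mul_rpow ha.le ht.le,
        ← mul_assoc, ← Real.rpow_add ha]
      simp
    rw [h1, lintegral_const_mul' _ _ ENNReal.ofReal_ne_top,
      lintegral_Ioi_comp_mul_left ha (fun t => ENNReal.ofReal (t ^ e) * h t ^ q.toReal),
      ← mul_assoc, ← ENNReal.ofReal_inv_of_pos ha, ← ENNReal.ofReal_mul (by positivity),
      ← Real.rpow_neg_one a, ← Real.rpow_add ha]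
    congr 3
    rw [he]; ring
  rw [key, ENNReal.mul_rpow_of_nonneg _ _ (by positivity),
    ENNReal.ofReal_rpow_of_nonneg (by positivity) (by positivity), ← Real.rpow_mul ha.le]
  congr 3
  field_simp

/-- The weighted norm of the indicator function of an interval `(0, a]`. -/
noncomputable def weightedNormInterval (p : ℝ) (q : ℝ≥0∞) (a : ℝ) : ℝ≥0∞ :=
  weightedNorm p q ((Ioc 0 a).indicator 1)

lemma weightedNormInterval_eq {p : ℝ} {q : ℝ≥0∞} (hq : 1 ≤ q) {a : ℝ} (ha : 0 < a) :
    weightedNormInterval p q a = ENNReal.ofReal (a ^ (1 / p)) * weightedNormInterval p q 1 := by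
  have := weightedNorm_comp_mul_left (p := p) hq (inv_pos.2 ha) ((Ioc 0 1).indicator 1)
  rw [Real.inv_rpow ha.le, Real.rpow_neg ha.le, inv_inv] at this
  rw [weightedNormInterval, weightedNormInterval, ← this]
  congr 1
  ext t
  have : a⁻¹ * t ≤ 1 ↔ t ≤ a := by rw [inv_mul_le_iff₀ ha, mul_one]
  simp [indicator, ha, this]

lemma weightedNormInterval_one_ne_zero {p : ℝ} {q : ℝ≥0∞} (hq : 1 ≤ q) :
    weightedNormInterval p q 1 ≠ 0 := by
  unfold weightedNormInterval
  by_cases hq' : q = ⊤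
  · subst hq'
    rw [weightedNorm_top]
    refine (lt_of_lt_of_le zero_lt_one (le_iSup₂_of_le 1 (mem_Ioi.2 one_pos) ?_)).ne'
    simp
  have hq1 := one_le_toReal_of_one_le hq hq'
  rw [weightedNorm, if_neg hq']
  refine (ENNReal.rpow_pos_of_nonneg ?_ (by positivity)).ne'
  rw [setLIntegral_pos_iff (by fun_prop (disch := measurability))]
  -- The integrand is positive on `(0, 1]`.
  refine lt_of_lt_of_le ?_ (measure_mono (s := Ioc (0 : ℝ) 1) fun t ht => ⟨?_, ht.1⟩)
  · simp
  · have : 0 < t ^ (q.toReal / p - 1) := Real.rpow_pos_of_pos ht.1 _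
    simp [indicator_of_mem ht, this]

lemma weightedNormInterval_one_ne_top {p : ℝ} (hp : 0 < p) {q : ℝ≥0∞} (hq : 1 ≤ q) :
    weightedNormInterval p q 1 ≠ ⊤ := by
  unfold weightedNormInterval
  by_cases hq' : q = ⊤
  · subst hq'
    rw [weightedNorm_top]
    refine (lt_of_le_of_lt (iSup₂_le fun t ht => ?_) ENNReal.one_lt_top).ne
    by_cases ht1 : t ∈ Ioc (0 : ℝ) 1
    · rw [indicator_of_mem ht1, Pi.one_apply, mul_one, ENNReal.ofReal_le_one]
      exact Real.rpow_le_one ht1.1.le ht1.2 (by positivity)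
    · simp [indicator_of_notMem ht1]
  have hq1 := one_le_toReal_of_one_le hq hq'
  rw [weightedNorm, if_neg hq']
  refine ENNReal.rpow_ne_top_of_nonneg (by positivity) ?_
  have h1 : ∀ t : ℝ, ENNReal.ofReal (t ^ (q.toReal / p - 1)) *
      (Ioc (0 : ℝ) 1).indicator (1 : ℝ → ℝ≥0∞) t ^ q.toReal =
      (Ioc (0 : ℝ) 1).indicator (fun t => ENNReal.ofReal (t ^ (q.toReal / p - 1))) t := by
    intro t
    by_cases ht : t ∈ Ioc (0 : ℝ) 1
    · simp [indicator_of_mem ht]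
    · rw [indicator_of_notMem ht, indicator_of_notMem ht, ENNReal.zero_rpow_of_pos (by linarith),
        mul_zero]
  simp_rw [h1]
  rw [setLIntegral_indicator measurableSet_Ioc,
    inter_eq_left.2 (Ioc_subset_Ioi_self : Ioc (0 : ℝ) 1 ⊆ Ioi 0)]
  have hint : IntegrableOn (fun t : ℝ => t ^ (q.toReal / p - 1)) (Ioc 0 1) := by
    rw [← intervalIntegrable_iff_integrableOn_Ioc_of_le zero_le_one]
    refine intervalIntegral.intervalIntegrable_rpow' ?_
    have : 0 < q.toReal / p := by positivity
    linarith
  exact hint.lintegral_lt_top.ne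

/-- A non-increasing function is controlled pointwise by its weighted norm: this is the embedding of
`L^{p,q}` into `L^{p,∞}`. -/
lemma rpow_mul_mul_le_weightedNorm {p : ℝ} {q : ℝ≥0∞} (hq : 1 ≤ q) {h : ℝ → ℝ≥0∞}
    (hh : Antitone h) {t : ℝ} (ht : 0 < t) :
    ENNReal.ofReal (t ^ (1 / p)) * h t * weightedNormInterval p q 1 ≤ weightedNorm p q h := by
  calc ENNReal.ofReal (t ^ (1 / p)) * h t * weightedNormInterval p q 1
      = h t * weightedNormInterval p q t := by rw [weightedNormInterval_eq hq ht]; ring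
    _ = weightedNorm p q (fun s => h t * (Ioc 0 t).indicator 1 s) :=
        (weightedNorm_const_mul hq (measurable_one.indicator measurableSet_Ioc) _).symm
    _ ≤ weightedNorm p q h := weightedNorm_mono fun s hs => by
        by_cases hst : s ≤ t
        · simpa [indicator_of_mem (show s ∈ Ioc 0 t from ⟨hs, hst⟩)] using hh hst
        · simp [indicator, hst]

lemma weightedNorm_top_le {p : ℝ} (hp : 0 < p) {q : ℝ≥0∞} (hq : 1 ≤ q) {h : ℝ → ℝ≥0∞}
    (hh : Antitone h) :
    weightedNorm p ⊤ h ≤ (weightedNormInterval p q 1)⁻¹ * weightedNorm p q h := by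
  rw [weightedNorm_top]
  refine iSup₂_le fun t ht => ?_
  rw [mul_comm (_⁻¹), ← div_eq_mul_inv, ENNReal.le_div_iff_mul_le
    (.inl (weightedNormInterval_one_ne_zero hq)) (.inl (weightedNormInterval_one_ne_top hp hq))]
  exact rpow_mul_mul_le_weightedNorm hq hh ht

lemma weightedNorm_add_le {p : ℝ} {q : ℝ≥0∞} (hq : 1 ≤ q) {h k : ℝ → ℝ≥0∞}
    (hh : Measurable h) (hk : Measurable k) :
    weightedNorm p q (fun t => h t + k t) ≤ weightedNorm p q h + weightedNorm p q k := by
  by_cases hq' : q = ⊤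
  · subst hq'
    simp_rw [weightedNorm_top, mul_add]
    exact iSup₂_le fun t ht => add_le_add
      (le_iSup₂ (f := fun t (_ : t ∈ Ioi (0 : ℝ)) => ENNReal.ofReal (t ^ (1 / p)) * h t) t ht)
      (le_iSup₂ (f := fun t (_ : t ∈ Ioi (0 : ℝ)) => ENNReal.ofReal (t ^ (1 / p)) * k t) t ht)
  simp_rw [weightedNorm_eq_eLpNorm' hq hq', mul_add]
  exact eLpNorm'_add_le (by fun_prop : Measurable _).aestronglyMeasurable
    (by fun_prop : Measurable _).aestronglyMeasurable (one_le_toReal_of_one_le hq hq')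

/-! ### The decreasing rearrangement -/

section Rearrangement

variable {X : Type*} [MeasurableSpace X] {μ : Measure X} {f g : X → ℝ}

lemma distribution_antitone (μ : Measure X) (f : X → ℝ) : Antitone (distribution μ f) :=
  fun _ _ hst => measure_mono fun _ hx => lt_of_le_of_lt (NNReal.coe_le_coe.2 hst) hx

lemma rearrangement_antitone (μ : Measure X) (f : X → ℝ) : Antitone (rearrangement μ f) :=
  fun _ _ hst => le_iInf₂ fun s hs => iInf₂_le s (hs.trans (ENNReal.ofReal_le_ofReal hst))

lemma measurable_rearrangement (μ : Measure X) (f : X → ℝ) : Measurable (rearrangement μ f) :=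
  (rearrangement_antitone μ f).measurable

/-- The distribution function is right-continuous. -/
lemma exists_lt_distribution {u : ℝ≥0} {a : ℝ≥0∞} (h : a < distribution μ f u) :
    ∃ v, u < v ∧ a < distribution μ f v := by
  have hUnion : {x | (u : ℝ) < |f x|} =
      ⋃ n : ℕ, {x | ((u + 1 / ((n : ℝ≥0) + 1) : ℝ≥0) : ℝ) < |f x|} := by
    ext x
    simp only [mem_ofPred_eq, mem_iUnion]
    refine ⟨fun hx => ?_, fun ⟨n, hn⟩ => lt_of_le_of_lt (by push_cast; simp; positivity) hn⟩
    obtain ⟨n, hn⟩ := exists_nat_one_div_lt (sub_pos.2 hx)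
    exact ⟨n, by push_cast; linarith⟩
  have hmono : Monotone fun n : ℕ => {x | ((u + 1 / ((n : ℝ≥0) + 1) : ℝ≥0) : ℝ) < |f x|} := by
    intro m n hmn x hx
    refine lt_of_le_of_lt (NNReal.coe_le_coe.2 ?_) hx
    gcongr
  rw [distribution, hUnion, hmono.measure_iUnion, lt_iSup_iff] at h
  obtain ⟨n, hn⟩ := h
  exact ⟨_, by simp, hn⟩

lemma rearrangement_le {u : ℝ≥0} {t : ℝ} (h : distribution μ f u ≤ ENNReal.ofReal t) :
    rearrangement μ f t ≤ u := iInf₂_le u h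

/-- The rearrangement is the generalized inverse of the distribution function. -/
lemma lt_rearrangement_iff {u : ℝ≥0} {t : ℝ} :
    (u : ℝ≥0∞) < rearrangement μ f t ↔ ENNReal.ofReal t < distribution μ f u := by
  refine ⟨fun h => ?_, fun h => ?_⟩
  · by_contra! h'
    exact (rearrangement_le h').not_gt h
  · obtain ⟨v, huv, hv⟩ := exists_lt_distribution h
    refine lt_of_lt_of_le (ENNReal.coe_lt_coe.2 huv) (le_iInf₂ fun s hs => ?_)
    by_contra! hsv
    exact (hs.trans_lt hv).not_ge (distribution_antitone μ f (ENNReal.coe_lt_coe.1 hsv).le)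

lemma rearrangement_le_iff {u : ℝ≥0} {t : ℝ} :
    rearrangement μ f t ≤ u ↔ distribution μ f u ≤ ENNReal.ofReal t := by
  simpa using lt_rearrangement_iff.not

lemma rearrangement_add_le {s t : ℝ} (hs : 0 ≤ s) (ht : 0 ≤ t) :
    rearrangement μ (f + g) (s + t) ≤ rearrangement μ f s + rearrangement μ g t := by
  rw [rearrangement, rearrangement, ENNReal.iInf_add]
  refine le_iInf fun u => ?_
  rw [ENNReal.iInf_add]
  refine le_iInf fun hu => ?_
  rw [rearrangement, ENNReal.add_iInf]
  refine le_iInf fun v => ?_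
  rw [ENNReal.add_iInf]
  refine le_iInf fun hv => ?_
  rw [← ENNReal.coe_add]
  refine iInf₂_le _ ?_
  rw [ENNReal.ofReal_add hs ht]
  refine (measure_mono (t := {x | (u : ℝ) < |f x|} ∪ {x | (v : ℝ) < |g x|}) fun x hx => ?_).trans
    ((measure_union_le _ _).trans (add_le_add hu hv))
  by_contra! h
  simp only [mem_union, mem_ofPred_eq, not_or, not_lt] at h
  have hx : ((u + v : ℝ≥0) : ℝ) < |f x + g x| := hx
  push_cast at hx
  linarith [abs_add_le (f x) (g x)]

lemma rearrangement_neg (μ : Measure X) (f : X → ℝ) : rearrangement μ (-f) = rearrangement μ f := by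
  ext t; simp [rearrangement, distribution]

lemma volume_Ioc_inter_ofReal_lt (t : ℝ) (b : ℝ≥0∞) :
    volume {s ∈ Ioc 0 t | ENNReal.ofReal s < b} = min (ENNReal.ofReal t) b := by
  by_cases hb : ENNReal.ofReal t < b
  · have : {s ∈ Ioc 0 t | ENNReal.ofReal s < b} = Ioc 0 t := by
      ext s
      simp only [mem_ofPred_eq, and_iff_left_iff_imp]
      exact fun hs => (ENNReal.ofReal_le_ofReal hs.2).trans_lt hb
    rw [this, Real.volume_Ioc, sub_zero, min_eq_left hb.le]
  · push Not at hb
    have hb' : b ≠ ⊤ := ne_top_of_le_ne_top ENNReal.ofReal_ne_top hb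
    have hbt : b.toReal ≤ max t 0 := by
      have := ENNReal.toReal_mono ENNReal.ofReal_ne_top hb
      rwa [ENNReal.toReal_ofReal'] at this
    have : {s ∈ Ioc 0 t | ENNReal.ofReal s < b} = Ioo 0 b.toReal := by
      ext s
      simp only [mem_ofPred_eq, mem_Ioc, mem_Ioo, and_assoc]
      refine and_congr_right fun hs => ?_
      rw [ENNReal.ofReal_lt_iff_lt_toReal hs.le hb']
      refine ⟨fun h => h.2, fun h => ⟨?_, h⟩⟩
      rcases le_max_iff.1 hbt with h' | h' <;> linarith
    rw [this, Real.volume_Ioo, sub_zero, min_eq_right hb, ENNReal.ofReal_toReal hb']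

/-- The layer cake formula for functions with values in `[0, ∞]`. -/
lemma lintegral_eq_lintegral_measure_ofReal_lt {Y : Type*} [MeasurableSpace Y] (ν : Measure Y)
    [SFinite ν] {h : Y → ℝ≥0∞} (hh : Measurable h) :
    ∫⁻ y, h y ∂ν = ∫⁻ u in Ioi (0 : ℝ), ν {y | ENNReal.ofReal u < h y} := by
  have hset : MeasurableSet {z : Y × ℝ | ENNReal.ofReal z.2 < h z.1} :=
    measurableSet_lt (by fun_prop) (by fun_prop)
  have hpt (a : ℝ≥0∞) : volume.restrict (Ioi (0 : ℝ)) {u : ℝ | ENNReal.ofReal u < a} = a := by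
    have hm : MeasurableSet {u : ℝ | ENNReal.ofReal u < a} :=
      measurableSet_lt (by fun_prop) (by fun_prop)
    rw [Measure.restrict_apply hm]
    by_cases ha : a = ⊤
    · simp [ha]
    · have : {u : ℝ | ENNReal.ofReal u < a} ∩ Ioi 0 = Ioo 0 a.toReal := by
        ext u
        simp only [mem_inter_iff, mem_ofPred_eq, mem_Ioi, mem_Ioo]
        rw [and_comm]
        exact and_congr_right fun hu => ENNReal.ofReal_lt_iff_lt_toReal hu.le ha
      rw [this, Real.volume_Ioo, sub_zero, ENNReal.ofReal_toReal ha]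
  have h1 := Measure.prod_apply (μ := ν) (ν := volume.restrict (Ioi (0 : ℝ))) hset
  have h2 := Measure.prod_apply_symm (μ := ν) (ν := volume.restrict (Ioi (0 : ℝ))) hset
  rw [h1] at h2
  simp only [preimage_ofPred_eq, hpt] at h2
  exact h2

/-- Integrating the rearrangement over `(0, t]` amounts to integrating the distribution function
capped at `t`, since each is the generalized inverse of the other. -/
lemma lintegral_rearrangement (μ : Measure X) (f : X → ℝ) (t : ℝ) :
    ∫⁻ s in Ioc 0 t, rearrangement μ f s =
      ∫⁻ u in Ioi (0 : ℝ), min (ENNReal.ofReal t) (distribution μ f u.toNNReal) := by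
  rw [lintegral_eq_lintegral_measure_ofReal_lt _ (measurable_rearrangement μ f)]
  refine lintegral_congr fun u => ?_
  have hm : MeasurableSet {s : ℝ | ENNReal.ofReal u < rearrangement μ f s} :=
    measurableSet_lt (by fun_prop) (measurable_rearrangement μ f)
  rw [Measure.restrict_apply hm, ← volume_Ioc_inter_ofReal_lt]
  congr 1
  ext s
  simp only [mem_inter_iff, mem_ofPred_eq]
  rw [and_comm]
  exact and_congr_right fun hs => lt_rearrangement_iff

/-- The integral of `|f|` over a set is at most the integral of the rearrangement over an interval
of the same measure. -/
lemma setLIntegral_le_lintegral_rearrangement (hf : Measurable f) {E : Set X}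
    {t : ℝ} (hE : μ E ≤ ENNReal.ofReal t) :
    ∫⁻ x in E, ‖f x‖ₑ ∂μ ≤ ∫⁻ s in Ioc 0 t, rearrangement μ f s := by
  have : Fact (μ E < ⊤) := ⟨hE.trans_lt ENNReal.ofReal_lt_top⟩
  rw [lintegral_rearrangement, lintegral_eq_lintegral_measure_ofReal_lt _ hf.enorm]
  refine setLIntegral_mono' measurableSet_Ioi fun u hu => ?_
  have hu : (0 : ℝ) < u := hu
  have hset : {x | ENNReal.ofReal u < ‖f x‖ₑ} = {x | ((u.toNNReal : ℝ≥0) : ℝ) < |f x|} := by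
    ext x
    rw [mem_ofPred_eq, mem_ofPred_eq, Real.enorm_eq_ofReal_abs,
      ENNReal.ofReal_lt_ofReal_iff_of_nonneg hu.le, Real.coe_toNNReal _ hu.le]
  refine le_min (((measure_mono (subset_univ _)).trans_eq ?_).trans hE)
    ((Measure.restrict_apply_le _ _).trans_eq (by rw [hset]; rfl))
  simp

/-- Splitting a function into a bounded part and a part controlled in `L^1` bounds its
rearrangement. -/
lemma rearrangement_le_of_enorm_le_add {F : X → ℝ} {G : X → ℝ≥0∞} (hG : AEMeasurable G μ)
    {a : ℝ≥0∞} (h : ∀ x, ‖F x‖ₑ ≤ a + G x) {t : ℝ} (ht : 0 < t) :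
    rearrangement μ F t ≤ a + (ENNReal.ofReal t)⁻¹ * ∫⁻ x, G x ∂μ := by
  refine le_of_forall_gt fun c hc => ?_
  obtain ⟨c', hc', hcc'⟩ := ENNReal.lt_iff_exists_nnreal_btwn.1 hc
  refine (rearrangement_le ?_).trans_lt hcc'
  have hlt : (ENNReal.ofReal t)⁻¹ * ∫⁻ x, G x ∂μ < c' - a := lt_tsub_iff_left.2 hc'
  calc distribution μ F c' ≤ μ {x | c' - a ≤ G x} := measure_mono fun x hx => by
        have hx' : (c' : ℝ≥0∞) < ‖F x‖ₑ := by
          rw [Real.enorm_eq_ofReal_abs, ← ENNReal.ofReal_coe_nnreal]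
          exact (ENNReal.ofReal_lt_ofReal_iff_of_nonneg c'.2).2 hx
        exact tsub_le_iff_left.2 (hx'.le.trans (h x))
    _ ≤ (∫⁻ x, G x ∂μ) / (c' - a) :=
        meas_ge_le_lintegral_div hG (zero_le.trans_lt hlt).ne'
          (ENNReal.sub_ne_top ENNReal.coe_ne_top)
    _ ≤ ENNReal.ofReal t := by
        refine ENNReal.div_le_of_le_mul' ?_
        rw [mul_comm, ← div_eq_mul_inv] at hlt
        exact (ENNReal.div_le_iff_le_mul (.inl (by simpa using ht))
          (.inl ENNReal.ofReal_ne_top)).1 hlt.le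

end Rearrangement

/-! ### Hardy's inequality and the equivalence of the two norms -/

/-- The constant in Hardy's inequality obtained by dyadic decomposition. -/
noncomputable def hardyConst (p : ℝ) : ℝ≥0∞ :=
  ∑' k : ℕ, ENNReal.ofReal ((1 / 2) ^ (k + 1)) *
    ENNReal.ofReal (((1 / 2 : ℝ) ^ (k + 1)) ^ (-(1 / p)))

lemma hardyConst_ne_top {p : ℝ} (hp : 1 < p) : hardyConst p ≠ ⊤ := by
  have hp' : 0 < 1 - 1 / p := by
    rw [sub_pos, div_lt_one (by linarith)]; exact hp
  have h (k : ℕ) : ENNReal.ofReal ((1 / 2) ^ (k + 1)) *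
      ENNReal.ofReal (((1 / 2 : ℝ) ^ (k + 1)) ^ (-(1 / p))) =
      ENNReal.ofReal (((1 / 2 : ℝ) ^ (1 - 1 / p)) ^ (k + 1)) := by
    rw [← ENNReal.ofReal_mul (by positivity), ← Real.rpow_one_add' (by positivity)
      (by rw [← sub_eq_add_neg]; exact hp'.ne'), ← sub_eq_add_neg, ← Real.rpow_natCast,
      ← Real.rpow_natCast, ← Real.rpow_mul (by positivity), ← Real.rpow_mul (by positivity),
      mul_comm]
  have hρ : (1 / 2 : ℝ) ^ (1 - 1 / p) < 1 := Real.rpow_lt_one (by norm_num) (by norm_num) hp'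
  rw [hardyConst]
  simp_rw [h]
  rw [← ENNReal.ofReal_tsum_of_nonneg (fun k => by positivity)]
  · exact ENNReal.ofReal_ne_top
  · exact (summable_nat_add_iff 1).2 (summable_geometric_of_lt_one (by positivity) hρ)

/-- The average of a non-increasing function over `(0, t]` is dominated by a convergent
combination of its dilates. -/
lemma average_le_tsum_of_antitone {h : ℝ → ℝ≥0∞} (hh : Antitone h) {t : ℝ} (ht : 0 < t) :
    (ENNReal.ofReal t)⁻¹ * ∫⁻ s in Ioc 0 t, h s ≤
      ∑' k : ℕ, ENNReal.ofReal ((1 / 2) ^ (k + 1)) * h ((1 / 2) ^ (k + 1) * t) := by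
  have hsub : Ioc 0 t ⊆ ⋃ k : ℕ, Ioc ((1 / 2) ^ (k + 1) * t) ((1 / 2) ^ k * t) := by
    intro s hs
    obtain ⟨n, hn, hn'⟩ := exists_nat_pow_near_of_lt_one (div_pos hs.1 ht)
      ((div_le_one ht).2 hs.2) (by norm_num : (0 : ℝ) < 1 / 2) (by norm_num)
    exact mem_iUnion.2 ⟨n, (lt_div_iff₀ ht).1 hn, (div_le_iff₀ ht).1 hn'⟩
  have hpiece (k : ℕ) : ∫⁻ s in Ioc ((1 / 2) ^ (k + 1) * t) ((1 / 2) ^ k * t), h s ≤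
      ENNReal.ofReal t * (ENNReal.ofReal ((1 / 2) ^ (k + 1)) * h ((1 / 2) ^ (k + 1) * t)) := by
    calc ∫⁻ s in Ioc ((1 / 2) ^ (k + 1) * t) ((1 / 2) ^ k * t), h s
        ≤ ∫⁻ s in Ioc ((1 / 2) ^ (k + 1) * t) ((1 / 2) ^ k * t), h ((1 / 2) ^ (k + 1) * t) :=
          setLIntegral_mono' measurableSet_Ioc fun s hs => hh hs.1.le
      _ = _ := by
          rw [setLIntegral_const, Real.volume_Ioc, ← mul_assoc, ← ENNReal.ofReal_mul ht.le,
            mul_comm]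
          congr 2
          ring
  calc (ENNReal.ofReal t)⁻¹ * ∫⁻ s in Ioc 0 t, h s
      ≤ (ENNReal.ofReal t)⁻¹ * ∑' k : ℕ,
          ENNReal.ofReal t * (ENNReal.ofReal ((1 / 2) ^ (k + 1)) * h ((1 / 2) ^ (k + 1) * t)) := by
        gcongr
        exact (lintegral_mono_set hsub).trans ((lintegral_iUnion_le _ _).trans
          (ENNReal.tsum_le_tsum hpiece))
    _ = _ := by
        rw [ENNReal.tsum_mul_left, ← mul_assoc, ENNReal.inv_mul_cancel (by simpa using ht)
          ENNReal.ofReal_ne_top, one_mul]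

section Lorentz

variable {X : Type*} [MeasurableSpace X] {μ : Measure X} {f g : X → ℝ}

lemma measurable_maximalRearrangement (μ : Measure X) (f : X → ℝ) :
    Measurable (maximalRearrangement μ f) := by
  have : Monotone fun t : ℝ => ∫⁻ s in Ioc (0 : ℝ) t, rearrangement μ f s := fun s t hst =>
    lintegral_mono_set (Ioc_subset_Ioc_right hst)
  exact ENNReal.measurable_ofReal.inv.mul this.measurable

/-- Hardy's inequality: Minkowski's inequality applied to the dyadic bound for the average `f**`. -/
lemma weightedNorm_maximalRearrangement_le {p : ℝ} {q : ℝ≥0∞} (hq : 1 ≤ q)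
    (μ : Measure X) (f : X → ℝ) :
    weightedNorm p q (maximalRearrangement μ f) ≤
      hardyConst p * weightedNorm p q (rearrangement μ f) := by
  have hm := measurable_rearrangement μ f
  calc weightedNorm p q (maximalRearrangement μ f)
      ≤ weightedNorm p q (fun t => ∑' k : ℕ, ENNReal.ofReal ((1 / 2) ^ (k + 1)) *
          rearrangement μ f ((1 / 2) ^ (k + 1) * t)) :=
        weightedNorm_mono fun t ht => average_le_tsum_of_antitone (rearrangement_antitone μ f) ht
    _ ≤ ∑' k : ℕ, weightedNorm p q (fun t => ENNReal.ofReal ((1 / 2) ^ (k + 1)) *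
          rearrangement μ f ((1 / 2) ^ (k + 1) * t)) :=
        weightedNorm_tsum_le hq fun k => by fun_prop
    _ = hardyConst p * weightedNorm p q (rearrangement μ f) := by
        rw [hardyConst, ← ENNReal.tsum_mul_right]
        refine tsum_congr fun k => ?_
        rw [weightedNorm_const_mul hq (by fun_prop), weightedNorm_comp_mul_left hq (by positivity),
          mul_assoc]

lemma lorentzNormMax_le {p : ℝ} {q : ℝ≥0∞} (hq : 1 ≤ q) (μ : Measure X) (f : X → ℝ) :
    lorentzNormMax μ p q f ≤ hardyConst p * lorentzNorm μ p q f :=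
  weightedNorm_maximalRearrangement_le hq μ f

lemma rearrangement_le_maximalRearrangement (μ : Measure X) (f : X → ℝ) {t : ℝ} (ht : 0 < t) :
    rearrangement μ f t ≤ maximalRearrangement μ f t := by
  have hle : rearrangement μ f t * ENNReal.ofReal t ≤
      ∫⁻ s in Ioc (0 : ℝ) t, rearrangement μ f s := by
    calc rearrangement μ f t * ENNReal.ofReal t
        = ∫⁻ s in Ioc (0 : ℝ) t, rearrangement μ f t := by
          rw [setLIntegral_const, Real.volume_Ioc, sub_zero]
      _ ≤ _ := setLIntegral_mono' measurableSet_Ioc fun s hs => rearrangement_antitone μ f hs.2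
  rw [maximalRearrangement, mul_comm, ← div_eq_mul_inv, ENNReal.le_div_iff_mul_le
    (.inl (by simpa using ht)) (.inl ENNReal.ofReal_ne_top)]
  exact hle

lemma lorentzNorm_le_lorentzNormMax (μ : Measure X) (p : ℝ) (q : ℝ≥0∞) (f : X → ℝ) :
    lorentzNorm μ p q f ≤ lorentzNormMax μ p q f :=
  weightedNorm_mono fun _ ht => rearrangement_le_maximalRearrangement μ f ht

/-- The constant in the embedding of `L^{p,q}` into the locally integrable functions. -/
noncomputable def integralConst (p : ℝ) (q : ℝ≥0∞) : ℝ≥0∞ :=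
  hardyConst p * (weightedNormInterval p q 1)⁻¹

lemma integralConst_ne_top {p : ℝ} (hp : 1 < p) {q : ℝ≥0∞} (hq : 1 ≤ q) :
    integralConst p q ≠ ⊤ :=
  ENNReal.mul_ne_top (hardyConst_ne_top hp)
    (ENNReal.inv_ne_top.2 (weightedNormInterval_one_ne_zero hq))

/-- The embedding of `L^{p,q}` into `L^{p,∞}`, combined with Hardy's inequality in `L^{p,∞}`. -/
lemma lintegral_rearrangement_le {p : ℝ} (hp : 1 < p) {q : ℝ≥0∞} (hq : 1 ≤ q)
    (μ : Measure X) (f : X → ℝ) {t : ℝ} (ht : 0 < t) :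
    ∫⁻ s in Ioc 0 t, rearrangement μ f s ≤
      ENNReal.ofReal (t ^ (1 - 1 / p)) * (integralConst p q * lorentzNorm μ p q f) := by
  have h : ENNReal.ofReal (t ^ (1 / p)) * maximalRearrangement μ f t ≤
      integralConst p q * lorentzNorm μ p q f := by
    calc ENNReal.ofReal (t ^ (1 / p)) * maximalRearrangement μ f t
        ≤ weightedNorm p ⊤ (maximalRearrangement μ f) := by
          rw [weightedNorm_top]
          exact le_iSup₂ (f := fun t (_ : t ∈ Ioi (0 : ℝ)) =>
            ENNReal.ofReal (t ^ (1 / p)) * maximalRearrangement μ f t) t ht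
      _ ≤ hardyConst p * weightedNorm p ⊤ (rearrangement μ f) :=
          weightedNorm_maximalRearrangement_le le_top μ f
      _ ≤ _ := by
          rw [integralConst, mul_assoc]
          gcongr
          exact weightedNorm_top_le (by linarith) hq (rearrangement_antitone μ f)
  calc ∫⁻ s in Ioc 0 t, rearrangement μ f s
      = ENNReal.ofReal (t ^ (1 - 1 / p)) *
          (ENNReal.ofReal (t ^ (1 / p)) * maximalRearrangement μ f t) := by
        rw [maximalRearrangement, ← mul_assoc, ← mul_assoc, ← ENNReal.ofReal_mul (by positivity),
          ← Real.rpow_add ht, sub_add_cancel, Real.rpow_one,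
          ENNReal.mul_inv_cancel (by simpa using ht) ENNReal.ofReal_ne_top, one_mul]
    _ ≤ _ := by gcongr

/-- Functions in `L^{p,q}` are integrable, with uniform control, over sets of finite measure. -/
lemma setLIntegral_le_lorentzNorm {p : ℝ} (hp : 1 < p) {q : ℝ≥0∞} (hq : 1 ≤ q)
    (hf : Measurable f) {E : Set X} (hE : μ E ≠ ⊤) :
    ∫⁻ x in E, ‖f x‖ₑ ∂μ ≤
      ENNReal.ofReal (μ.real E ^ (1 - 1 / p)) * (integralConst p q * lorentzNorm μ p q f) := by
  by_cases h0 : μ E = 0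
  · simp [Measure.restrict_eq_zero.2 h0]
  · have hpos : 0 < μ.real E := ENNReal.toReal_pos h0 hE
    exact (setLIntegral_le_lintegral_rearrangement hf (ENNReal.ofReal_toReal hE).ge).trans
      (lintegral_rearrangement_le hp hq μ f hpos)

/-- The quasi-triangle inequality. -/
lemma lorentzNorm_sub_le {p : ℝ} {q : ℝ≥0∞} (hq : 1 ≤ q) (μ : Measure X) (f g : X → ℝ) :
    lorentzNorm μ p q (f - g) ≤
      ENNReal.ofReal ((1 / 2 : ℝ) ^ (-(1 / p))) * (lorentzNorm μ p q f + lorentzNorm μ p q g) := by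
  have hf := measurable_rearrangement μ f
  have hg := measurable_rearrangement μ g
  calc lorentzNorm μ p q (f - g)
      ≤ weightedNorm p q (fun t => rearrangement μ f (1 / 2 * t) + rearrangement μ g (1 / 2 * t)) :=
        weightedNorm_mono fun t ht => by
          have := rearrangement_add_le (μ := μ) (f := f) (g := -g) (s := 1 / 2 * t) (t := 1 / 2 * t)
            (by positivity) (by positivity)
          rwa [rearrangement_neg, ← sub_eq_add_neg, ← add_mul, add_halves, one_mul] at this
    _ ≤ _ := weightedNorm_add_le hq (by fun_prop) (by fun_prop)
    _ = _ := by
        rw [weightedNorm_comp_mul_left hq (by norm_num),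
          weightedNorm_comp_mul_left hq (by norm_num), ← mul_add]
        rfl

end Lorentz

/-! ### Separability and the boundedness of the averaging operator -/

section Averaging

variable {X : Type*} [MetricSpace X] [MeasurableSpace X] {μ : Measure X}

/-- Countably many small disjoint balls cover almost all of `X`; as every ball has positive measure,
their centres form an almost dense set. -/
lemma secondCountableTopology_of_vitali
    (hball : ∀ (x : X) (s : ℝ), 0 < s → 0 < μ (Metric.closedBall x s))
    (hvitali : VitaliCoveringProperty μ) : SecondCountableTopology X := by
  refine Metric.secondCountable_of_almost_dense_set fun ε hε => ?_
  cases isEmpty_or_nonempty X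
  · exact ⟨∅, countable_empty, isEmptyElim⟩
  obtain ⟨𝓑, hsub, hcount, -, hnull⟩ := hvitali univ
    {b | ∃ x : X, ∃ s : ℝ, 0 < s ∧ s ≤ ε / 2 ∧ b = Metric.closedBall x s}
    ⟨ε / 2, fun b ⟨x, s, h⟩ => ⟨x, mem_univ x, s, h⟩⟩ fun x _ => by
      refine ⟨fun s hs => hs.1.le, fun l hl => ?_⟩
      by_contra! hl0
      have := hl (show min (l / 2) (ε / 2) ∈ {s : ℝ | 0 < s ∧ Metric.closedBall x s ∈ _} from
        ⟨by positivity, x, _, by positivity, min_le_right _ _, rfl⟩)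
      linarith [min_le_left (l / 2) (ε / 2)]
  have hsub' : ∀ b ∈ 𝓑, ∃ x : X, ∃ s : ℝ, 0 < s ∧ s ≤ ε / 2 ∧ b = Metric.closedBall x s :=
    fun b hb => hsub hb
  choose! c s hs hs' hb using hsub'
  refine ⟨c '' 𝓑, hcount.image c, fun x => ?_⟩
  obtain ⟨y, hy, hy'⟩ : ∃ y ∈ Metric.closedBall x (ε / 2), y ∈ ⋃₀ 𝓑 := by
    by_contra! h
    refine (hball x (ε / 2) (by positivity)).ne' (measure_mono_null (fun y hy => ?_) hnull)
    exact ⟨mem_univ y, h y hy⟩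
  obtain ⟨b, hb𝓑, hyb⟩ := hy'
  refine ⟨c b, mem_image_of_mem c hb𝓑, ?_⟩
  rw [hb b hb𝓑] at hyb
  have h1 := Metric.mem_closedBall.1 hyb
  have h2 := Metric.mem_closedBall'.1 hy
  linarith [dist_triangle x y (c b), hs' b hb𝓑]

lemma sigmaFinite_of_closedBall_lt_top [SecondCountableTopology X]
    (hfin : ∀ x : X, μ (Metric.closedBall x 1) < ⊤) : SigmaFinite μ := by
  have : IsLocallyFiniteMeasure μ :=
    ⟨fun x => ⟨_, Metric.closedBall_mem_nhds x one_pos, hfin x⟩⟩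
  exact sigmaFinite_of_locallyFinite

/-- The averages over balls of radius `r` of a function with values in `[0, ∞]`. -/
noncomputable def lintegralAverage (μ : Measure X) (r : ℝ) (g : X → ℝ≥0∞) (x : X) : ℝ≥0∞ :=
  (μ (Metric.closedBall x r))⁻¹ * ∫⁻ y in Metric.closedBall x r, g y ∂μ

/-- No integrability is needed: where the Bochner integral takes its default value `0`, the
right-hand side is still an upper bound. -/
lemma enorm_averaging_le {r : ℝ}
    (hball : ∀ x : X, 0 < μ (Metric.closedBall x r) ∧ μ (Metric.closedBall x r) < ⊤)
    (f : X → ℝ) (x : X) :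
    ‖averaging μ r f x‖ₑ ≤ lintegralAverage μ r (fun y => ‖f y‖ₑ) x := by
  have h : ‖(μ.real (Metric.closedBall x r))⁻¹‖ₑ = (μ (Metric.closedBall x r))⁻¹ := by
    rw [Real.enorm_of_nonneg (by positivity), Measure.real,
      ENNReal.ofReal_inv_of_pos (ENNReal.toReal_pos (hball x).1.ne' (hball x).2.ne),
      ENNReal.ofReal_toReal (hball x).2.ne]
  rw [averaging, enorm_mul, h, lintegralAverage]
  gcongr
  exact enorm_integral_le_lintegral_enorm f

lemma lintegralAverage_le_add {r : ℝ}
    (hball : ∀ x : X, 0 < μ (Metric.closedBall x r) ∧ μ (Metric.closedBall x r) < ⊤)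
    (g : X → ℝ≥0∞) (a : ℝ≥0∞) (x : X) :
    lintegralAverage μ r g x ≤ a + lintegralAverage μ r (fun y => g y - a) x := by
  unfold lintegralAverage
  calc (μ (Metric.closedBall x r))⁻¹ * ∫⁻ y in Metric.closedBall x r, g y ∂μ
      ≤ (μ (Metric.closedBall x r))⁻¹ * ∫⁻ y in Metric.closedBall x r, (a + (g y - a)) ∂μ := by
        gcongr with y
        exact le_add_tsub
    _ = a + (μ (Metric.closedBall x r))⁻¹ * ∫⁻ y in Metric.closedBall x r, (g y - a) ∂μ := by
        rw [lintegral_add_left measurable_const, setLIntegral_const, mul_add, mul_comm a,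
          ← mul_assoc, ENNReal.inv_mul_cancel (hball x).1.ne' (hball x).2.ne, one_mul]

variable [OpensMeasurableSpace X]

/-- The kernel whose integral in the second variable gives the averages of `g`. -/
noncomputable def averageKernel (μ : Measure X) (r : ℝ) (g : X → ℝ≥0∞) : X × X → ℝ≥0∞ :=
  {z : X × X | dist z.2 z.1 ≤ r}.indicator fun z => (μ (Metric.closedBall z.1 r))⁻¹ * g z.2

lemma lintegral_averageKernel (r : ℝ) {g : X → ℝ≥0∞} (hg : Measurable g) (x : X) :
    ∫⁻ y, averageKernel μ r g (x, y) ∂μ = lintegralAverage μ r g x := by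
  rw [lintegralAverage, ← lintegral_const_mul _ hg,
    ← lintegral_indicator Metric.isClosed_closedBall.measurableSet]
  rfl

section Tonelli

variable [SecondCountableTopology X]

lemma measurableSet_dist_le (r : ℝ) : MeasurableSet {z : X × X | dist z.2 z.1 ≤ r} :=
  (isClosed_le (by fun_prop) (by fun_prop)).measurableSet

variable [SigmaFinite μ]

lemma measurable_averageKernel (r : ℝ) {g : X → ℝ≥0∞} (hg : Measurable g) :
    Measurable (averageKernel μ r g) := by
  have hm : Measurable fun x : X => μ (Metric.closedBall x r) :=
    measurable_measure_prodMk_left (ν := μ) (measurableSet_dist_le r)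
  exact Measurable.indicator ((hm.comp measurable_fst).inv.mul (hg.comp measurable_snd))
    (measurableSet_dist_le r)

lemma measurable_lintegralAverage (r : ℝ) {g : X → ℝ≥0∞} (hg : Measurable g) :
    Measurable (lintegralAverage μ r g) := by
  rw [← funext (lintegral_averageKernel r hg)]
  exact (measurable_averageKernel r hg).lintegral_prod_right'

/-- Averaging is bounded on `L^1`: by Tonelli's theorem this reduces to comparing the measures of
the balls `B(x, r)` and `B(y, r)` for `dist x y ≤ r`. -/
lemma lintegral_lintegralAverage_le {r : ℝ}
    (hball : ∀ x : X, 0 < μ (Metric.closedBall x r) ∧ μ (Metric.closedBall x r) < ⊤)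
    {γ : ℝ≥0} (hγ : ∀ x : X, μ (Metric.closedBall x (2 * r)) ≤ γ * μ (Metric.closedBall x r))
    {g : X → ℝ≥0∞} (hg : Measurable g) :
    ∫⁻ x, lintegralAverage μ r g x ∂μ ≤ γ * ∫⁻ x, g x ∂μ := by
  simp_rw [← lintegral_averageKernel r hg]
  rw [lintegral_lintegral_swap (f := fun x y => averageKernel μ r g (x, y))
    (measurable_averageKernel r hg).aemeasurable, ← lintegral_const_mul _ hg]
  refine lintegral_mono fun y => ?_
  calc ∫⁻ x, averageKernel μ r g (x, y) ∂μ
      ≤ ∫⁻ x, (Metric.closedBall y r).indicator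
          (fun _ => γ * (μ (Metric.closedBall y r))⁻¹ * g y) x ∂μ := by
        refine lintegral_mono fun x => ?_
        by_cases hx : dist y x ≤ r
        · rw [averageKernel,
            indicator_of_mem (show (x, y) ∈ {z : X × X | dist z.2 z.1 ≤ r} from hx),
            indicator_of_mem (Metric.mem_closedBall'.2 hx)]
          gcongr
          have hle : μ (Metric.closedBall y r) ≤ γ * μ (Metric.closedBall x r) :=
            (measure_mono (Metric.closedBall_subset_closedBall' (by linarith))).trans (hγ x)
          rw [← div_eq_mul_inv, ENNReal.le_div_iff_mul_le (.inl (hball y).1.ne')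
            (.inl (hball y).2.ne), mul_comm, ← div_eq_mul_inv]
          exact ENNReal.div_le_of_le_mul hle
        · rw [averageKernel,
            indicator_of_notMem (show (x, y) ∉ {z : X × X | dist z.2 z.1 ≤ r} from hx)]
          exact zero_le
    _ = γ * g y := by
        rw [lintegral_indicator Metric.isClosed_closedBall.measurableSet, setLIntegral_const,
          mul_right_comm, mul_assoc (γ : ℝ≥0∞),
          ENNReal.inv_mul_cancel (hball y).1.ne' (hball y).2.ne, mul_one]

end Tonelli

variable [SecondCountableTopology X] [SigmaFinite μ]

/-- The basic estimate for averages, obtained by truncating `f` at height `f*(t)`. -/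
lemma rearrangement_averaging_le {r : ℝ}
    (hball : ∀ x : X, 0 < μ (Metric.closedBall x r) ∧ μ (Metric.closedBall x r) < ⊤)
    {γ : ℝ≥0} (hγ : ∀ x : X, μ (Metric.closedBall x (2 * r)) ≤ γ * μ (Metric.closedBall x r))
    {f : X → ℝ} (hf : Measurable f) {t : ℝ} (ht : 0 < t) :
    rearrangement μ (averaging μ r f) t ≤ (1 + γ) * maximalRearrangement μ f t := by
  have hle := rearrangement_le_maximalRearrangement μ f ht
  by_cases htop : rearrangement μ f t = ⊤
  · rw [htop, top_le_iff] at hle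
    simp [hle, ENNReal.mul_top]
  lift rearrangement μ f t to ℝ≥0 using htop with a ha
  -- The part of `|f|` above height `a = f*(t)` lives on a set of measure at most `t`.
  have hE : μ {x | (a : ℝ≥0∞) < ‖f x‖ₑ} ≤ ENNReal.ofReal t := by
    refine (measure_mono fun x hx => ?_).trans (rearrangement_le_iff.1 ha.ge)
    rw [mem_ofPred_eq, Real.enorm_eq_ofReal_abs, ← ENNReal.ofReal_coe_nnreal] at hx
    exact (ENNReal.ofReal_lt_ofReal_iff_of_nonneg a.2).1 hx
  have htrunc : ∫⁻ x, (‖f x‖ₑ - a) ∂μ ≤ ∫⁻ s in Ioc 0 t, rearrangement μ f s := by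
    refine le_trans ?_ (setLIntegral_le_lintegral_rearrangement hf hE)
    rw [← lintegral_indicator (measurableSet_lt measurable_const hf.enorm)]
    refine lintegral_mono fun x => ?_
    by_cases hx : (a : ℝ≥0∞) < ‖f x‖ₑ
    · rw [indicator_of_mem (show x ∈ {x | (a : ℝ≥0∞) < ‖f x‖ₑ} from hx)]
      exact tsub_le_self
    · rw [tsub_eq_zero_of_le (not_lt.1 hx)]
      exact zero_le
  have hm : Measurable fun x => ‖f x‖ₑ - (a : ℝ≥0∞) := hf.enorm.sub_const _
  calc rearrangement μ (averaging μ r f) t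
      ≤ a + (ENNReal.ofReal t)⁻¹ * ∫⁻ x, lintegralAverage μ r (fun y => ‖f y‖ₑ - a) x ∂μ :=
        rearrangement_le_of_enorm_le_add (measurable_lintegralAverage r hm).aemeasurable
          (fun x => (enorm_averaging_le hball f x).trans (lintegralAverage_le_add hball _ _ x)) ht
    _ ≤ a + (ENNReal.ofReal t)⁻¹ * (γ * ∫⁻ s in Ioc 0 t, rearrangement μ f s) := by
        gcongr
        exact (lintegral_lintegralAverage_le hball hγ hm).trans (by gcongr)
    _ ≤ maximalRearrangement μ f t + γ * maximalRearrangement μ f t := by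
        rw [mul_left_comm]
        exact add_le_add hle le_rfl
    _ = (1 + γ) * maximalRearrangement μ f t := by ring

lemma lorentzNorm_averaging_le {r : ℝ}
    (hball : ∀ x : X, 0 < μ (Metric.closedBall x r) ∧ μ (Metric.closedBall x r) < ⊤)
    {γ : ℝ≥0} (hγ : ∀ x : X, μ (Metric.closedBall x (2 * r)) ≤ γ * μ (Metric.closedBall x r))
    {p : ℝ} {q : ℝ≥0∞} (hq : 1 ≤ q) {f : X → ℝ} (hf : Measurable f) :
    lorentzNorm μ p q (averaging μ r f) ≤ (1 + γ) * lorentzNormMax μ p q f :=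
  (weightedNorm_mono fun _ ht => rearrangement_averaging_le hball hγ hf ht).trans_eq
    (weightedNorm_const_mul hq (measurable_maximalRearrangement μ f) _)

end Averaging

/-! ### Equicontinuity of averages -/

section Continuity

variable {X : Type*} [MetricSpace X] [MeasurableSpace X] {μ : Measure X}

omit [MetricSpace X] in
lemma integrableOn_of_lorentzNorm_lt_top {p : ℝ} (hp : 1 < p) {q : ℝ≥0∞} (hq : 1 ≤ q) {f : X → ℝ}
    (hf : Measurable f) (hN : lorentzNorm μ p q f < ⊤) {E : Set X} (hE : μ E ≠ ⊤) :
    IntegrableOn f E μ :=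
  ⟨hf.aestronglyMeasurable, (setLIntegral_le_lorentzNorm hp hq hf hE).trans_lt
    (ENNReal.mul_lt_top ENNReal.ofReal_lt_top
      (ENNReal.mul_lt_top (integralConst_ne_top hp hq).lt_top hN))⟩

omit [MetricSpace X] in
lemma abs_setIntegral_le {p : ℝ} (hp : 1 < p) {q : ℝ≥0∞} (hq : 1 ≤ q) {f : X → ℝ}
    (hf : Measurable f) (hN : lorentzNorm μ p q f < ⊤) {E : Set X} (hE : μ E ≠ ⊤) :
    |∫ x in E, f x ∂μ| ≤
      μ.real E ^ (1 - 1 / p) * (integralConst p q * lorentzNorm μ p q f).toReal := by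
  have h := (enorm_integral_le_lintegral_enorm f).trans (setLIntegral_le_lorentzNorm hp hq hf hE)
  have h' := ENNReal.toReal_mono (ENNReal.mul_ne_top ENNReal.ofReal_ne_top
    (ENNReal.mul_ne_top (integralConst_ne_top hp hq) hN.ne)) h
  rwa [toReal_enorm, Real.norm_eq_abs, ENNReal.toReal_mul,
    ENNReal.toReal_ofReal (by positivity)] at h'

variable [OpensMeasurableSpace X]

/-- The averages of the functions in a bounded subset of `L^{p,q}` are equicontinuous. -/
lemma exists_modulus_averaging {r : ℝ}
    (hball : ∀ x : X, 0 < μ (Metric.closedBall x r) ∧ μ (Metric.closedBall x r) < ⊤)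
    (hcont : ∀ x : X, Tendsto
      (fun y => μ (symmDiff (Metric.closedBall x r) (Metric.closedBall y r))) (𝓝 x) (𝓝 0))
    {p : ℝ} (hp : 1 < p) {q : ℝ≥0∞} (hq : 1 ≤ q) (x : X) :
    ∃ ω : X → ℝ, Tendsto ω (𝓝 x) (𝓝 0) ∧
      ∀ f : X → ℝ, Measurable f → lorentzNorm μ p q f < ⊤ → ∀ y,
        |averaging μ r f y - averaging μ r f x| ≤
          (integralConst p q * lorentzNorm μ p q f).toReal * ω y := by
  have hp' : 0 < 1 - 1 / p := by
    rw [sub_pos, div_lt_one (by linarith)]; exact hp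
  set B : X → Set X := fun y => Metric.closedBall y r
  have hBm : ∀ y, MeasurableSet (B y) := fun y => Metric.isClosed_closedBall.measurableSet
  have hBfin : ∀ y, μ (B y) ≠ ⊤ := fun y => (hball y).2.ne
  set D : X → ℝ := fun y => μ.real (symmDiff (B x) (B y))
  have hDfin : ∀ y, μ (symmDiff (B x) (B y)) ≠ ⊤ := fun y =>
    ne_top_of_le_ne_top (ENNReal.add_ne_top.2 ⟨hBfin x, hBfin y⟩)
      ((measure_mono symmDiff_subset_union).trans (measure_union_le _ _))
  have hD : Tendsto D (𝓝 x) (𝓝 0) := by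
    have := (ENNReal.tendsto_toReal ENNReal.zero_ne_top).comp (hcont x)
    rwa [ENNReal.toReal_zero] at this
  have hm : Tendsto (fun y => μ.real (B y)) (𝓝 x) (𝓝 (μ.real (B x))) := by
    rw [tendsto_iff_dist_tendsto_zero]
    refine squeeze_zero (fun _ => dist_nonneg) (fun y => ?_) hD
    rw [dist_comm, Real.dist_eq]
    exact abs_measureReal_sub_le_measureReal_symmDiff' (hBm x).nullMeasurableSet
      (hBm y).nullMeasurableSet (hBfin x) (hBfin y)
  have hmx : μ.real (B x) ≠ 0 := (ENNReal.toReal_pos (hball x).1.ne' (hBfin x)).ne'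
  -- The two terms come from varying the domain of integration and the normalizing factor.
  refine ⟨fun y => (μ.real (B y))⁻¹ * (2 * D y ^ (1 - 1 / p)) +
    |(μ.real (B y))⁻¹ - (μ.real (B x))⁻¹| * μ.real (B x) ^ (1 - 1 / p), ?_, ?_⟩
  · have h1 : Tendsto (fun y => D y ^ (1 - 1 / p)) (𝓝 x) (𝓝 0) := by
      have := hD.rpow_const (p := 1 - 1 / p) (.inr hp'.le)
      rwa [Real.zero_rpow hp'.ne'] at this
    have h2 := hm.inv₀ hmx
    have h3 := (h2.sub_const (μ.real (B x))⁻¹).abs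
    simpa using (h2.mul (h1.const_mul 2)).add (h3.mul_const (μ.real (B x) ^ (1 - 1 / p)))
  · intro f hf hN y
    set K := (integralConst p q * lorentzNorm μ p q f).toReal with hK
    have hK0 : 0 ≤ K := ENNReal.toReal_nonneg
    have hI := fun z => integrableOn_of_lorentzNorm_lt_top hp hq hf hN (hBfin z)
    have hdiff : ∀ E ⊆ symmDiff (B x) (B y), |∫ z in E, f z ∂μ| ≤ D y ^ (1 - 1 / p) * K := by
      intro E hE
      refine (abs_setIntegral_le hp hq hf hN
        (ne_top_of_le_ne_top (hDfin y) (measure_mono hE))).trans ?_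
      gcongr
      exact measureReal_mono hE (hDfin y)
    have hsub : |∫ z in B y, f z ∂μ - ∫ z in B x, f z ∂μ| ≤ 2 * D y ^ (1 - 1 / p) * K := by
      have e1 := integral_inter_add_sdiff (hBm x) (hI y)
      have e2 := integral_inter_add_sdiff (hBm y) (hI x)
      rw [inter_comm] at e2
      have b1 := abs_le.1 (hdiff (B y \ B x) subset_union_right)
      have b2 := abs_le.1 (hdiff (B x \ B y) subset_union_left)
      rw [abs_le]
      constructor <;> linarith [b1.1, b1.2, b2.1, b2.2]
    have hx := abs_setIntegral_le hp hq hf hN (hBfin x)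
    have hy0 : 0 ≤ (μ.real (B y))⁻¹ := by positivity
    have hsplit : averaging μ r f y - averaging μ r f x =
        (μ.real (B y))⁻¹ * (∫ z in B y, f z ∂μ - ∫ z in B x, f z ∂μ) +
          ((μ.real (B y))⁻¹ - (μ.real (B x))⁻¹) * ∫ z in B x, f z ∂μ := by
      simp only [averaging, B]
      ring
    calc |averaging μ r f y - averaging μ r f x|
        ≤ (μ.real (B y))⁻¹ * |∫ z in B y, f z ∂μ - ∫ z in B x, f z ∂μ| +
          |(μ.real (B y))⁻¹ - (μ.real (B x))⁻¹| * |∫ z in B x, f z ∂μ| := by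
          rw [hsplit]
          refine (abs_add_le _ _).trans_eq ?_
          rw [abs_mul, abs_mul, abs_of_nonneg hy0]
      _ ≤ (μ.real (B y))⁻¹ * (2 * D y ^ (1 - 1 / p) * K) +
          |(μ.real (B y))⁻¹ - (μ.real (B x))⁻¹| * (μ.real (B x) ^ (1 - 1 / p) * K) := by
          gcongr
      _ = _ := by ring

lemma continuous_averaging {r : ℝ}
    (hball : ∀ x : X, 0 < μ (Metric.closedBall x r) ∧ μ (Metric.closedBall x r) < ⊤)
    (hcont : ∀ x : X, Tendsto
      (fun y => μ (symmDiff (Metric.closedBall x r) (Metric.closedBall y r))) (𝓝 x) (𝓝 0))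
    {p : ℝ} (hp : 1 < p) {q : ℝ≥0∞} (hq : 1 ≤ q) {f : X → ℝ} (hf : Measurable f)
    (hN : lorentzNorm μ p q f < ⊤) : Continuous (averaging μ r f) := by
  refine continuous_iff_continuousAt.2 fun x => tendsto_iff_dist_tendsto_zero.2 ?_
  obtain ⟨ω, hω, h⟩ := exists_modulus_averaging hball hcont hp hq x
  exact squeeze_zero (fun _ => dist_nonneg) (fun y => h f hf hN y) (by simpa using hω.const_mul _)

/-- The averaging operator acts on the Lorentz spaces. -/
lemma mapsTo_averaging [SecondCountableTopology X] [SigmaFinite μ] {r : ℝ}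
    (hball : ∀ x : X, 0 < μ (Metric.closedBall x r) ∧ μ (Metric.closedBall x r) < ⊤)
    (hdoubling : IsDoublingAt μ r)
    (hcont : ∀ x : X, Tendsto
      (fun y => μ (symmDiff (Metric.closedBall x r) (Metric.closedBall y r))) (𝓝 x) (𝓝 0))
    {p : ℝ} (hp : 1 < p) {q : ℝ≥0∞} (hq : 1 ≤ q) :
    MapsTo (averaging μ r) (lorentzSpace μ p q) (lorentzSpace μ p q) := by
  obtain ⟨γ, -, hγ⟩ := hdoubling
  intro f ⟨hf, hN⟩
  refine ⟨(continuous_averaging hball hcont hp hq hf hN).measurable,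
    (lorentzNorm_averaging_le hball hγ hq hf).trans_lt (ENNReal.mul_lt_top (by simp) ?_)⟩
  exact (lorentzNormMax_le hq μ f).trans_lt (ENNReal.mul_lt_top (hardyConst_ne_top hp).lt_top hN)

end Continuity

/-! ### Compactness on bounded spaces -/

lemma IsCompactOn.of_equivalent {X : Type*} {E : Set (X → ℝ)} {N N' : (X → ℝ) → ℝ≥0∞}
    {T : (X → ℝ) → (X → ℝ)} {c c' : ℝ≥0∞} (hc : c ≠ ⊤) (hc' : c' ≠ ⊤)
    (h : ∀ f, N f ≤ c * N' f) (h' : ∀ f, N' f ≤ c' * N f) (hT : IsCompactOn E N T) :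
    IsCompactOn E N' T := by
  refine ⟨hT.1, fun f hf ⟨C, hC⟩ => ?_⟩
  obtain ⟨g, hg, φ, hφ, hlim⟩ := hT.2 f hf ⟨c.toNNReal * C, fun n => by
    rw [ENNReal.coe_mul, ENNReal.coe_toNNReal hc]
    exact (h _).trans (by gcongr; exact hC n)⟩
  refine ⟨g, hg, φ, hφ, tendsto_of_tendsto_of_tendsto_of_le_of_le tendsto_const_nhds ?_
    (fun _ => zero_le) (fun n => h' _)⟩
  simpa using ENNReal.Tendsto.const_mul hlim (.inr hc')

/-- A bounded pointwise equicontinuous sequence of functions on a separable space has a subsequence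
that converges pointwise. -/
lemma exists_subseq_tendsto_of_modulus {X : Type*} [TopologicalSpace X]
    [TopologicalSpace.SeparableSpace X]
    {F : ℕ → X → ℝ} {M : ℝ} (hM : ∀ n x, |F n x| ≤ M)
    (hF : ∀ x, ∃ ω : X → ℝ, Tendsto ω (𝓝 x) (𝓝 0) ∧ ∀ n y, |F n y - F n x| ≤ ω y) :
    ∃ (g : X → ℝ) (φ : ℕ → ℕ), StrictMono φ ∧
      ∀ x, Tendsto (fun n => F (φ n) x) atTop (𝓝 (g x)) := by
  cases isEmpty_or_nonempty X
  · exact ⟨isEmptyElim, id, strictMono_id, isEmptyElim⟩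
  have hK : IsCompact (Set.pi univ fun _ : ℕ => Icc (-M) M) := isCompact_univ_pi fun _ =>
    isCompact_Icc
  obtain ⟨a, -, φ, hφ, hlim⟩ := hK.tendsto_subseq
    (x := fun n k => F n (TopologicalSpace.denseSeq X k))
    fun n k _ => abs_le.1 (hM n _)
  have hcauchy : ∀ x, CauchySeq fun n => F (φ n) x := by
    intro x
    obtain ⟨ω, hω, h⟩ := hF x
    refine Metric.cauchySeq_iff.2 fun ε hε => ?_
    obtain ⟨_, hy, k, rfl⟩ := mem_closure_iff_nhds.1 (TopologicalSpace.denseRange_denseSeq X x) _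
      (hω.eventually_lt_const (by positivity : 0 < ε / 3))
    have hy : ω (TopologicalSpace.denseSeq X k) < ε / 3 := hy
    obtain ⟨N, hN⟩ := Metric.cauchySeq_iff.1 (tendsto_pi_nhds.1 hlim k).cauchySeq (ε / 3)
      (by positivity)
    refine ⟨N, fun m hm n hn => ?_⟩
    have h1 := abs_le.1 (h (φ m) (TopologicalSpace.denseSeq X k))
    have h2 := abs_le.1 (h (φ n) (TopologicalSpace.denseSeq X k))
    have h3 := abs_lt.1 (hN m hm n hn)
    simp only [Function.comp_apply] at h3
    rw [Real.dist_eq, abs_lt]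
    constructor <;> linarith [h1.1, h1.2, h2.1, h2.2, h3.1, h3.2]
  choose g hg using fun x => cauchySeq_tendsto_of_complete (hcauchy x)
  exact ⟨g, φ, hφ, hg⟩

section Lorentz

variable {X : Type*} [MeasurableSpace X] {μ : Measure X}

lemma weightedNormInterval_ne_top {p : ℝ} (hp : 0 < p) {q : ℝ≥0∞} (hq : 1 ≤ q) {a : ℝ}
    (ha : 0 < a) : weightedNormInterval p q a ≠ ⊤ := by
  rw [weightedNormInterval_eq hq ha]
  exact ENNReal.mul_ne_top ENNReal.ofReal_ne_top (weightedNormInterval_one_ne_top hp hq)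

/-- The norm of a function bounded by `M`, supported on a set of measure at most `T`, and exceeding
`ε` only on a set of measure at most `δ`: its rearrangement is at most `M` on `(0, δ]`, at most `ε`
on `(δ, T]`, and vanishes beyond `T`. -/
lemma lorentzNorm_le_of_abs_le {p : ℝ} {q : ℝ≥0∞} (hq : 1 ≤ q) {h : X → ℝ} {M ε : ℝ≥0} {δ T : ℝ}
    (hM : ∀ x, |h x| ≤ M) (hδ : distribution μ h ε ≤ ENNReal.ofReal δ)
    (hT : distribution μ h 0 ≤ ENNReal.ofReal T) :
    lorentzNorm μ p q h ≤ M * weightedNormInterval p q δ + ε * weightedNormInterval p q T := by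
  have hmeas : ∀ a : ℝ, Measurable ((Ioc 0 a).indicator (1 : ℝ → ℝ≥0∞)) := fun a =>
    measurable_one.indicator measurableSet_Ioc
  calc lorentzNorm μ p q h
      ≤ weightedNorm p q (fun t => M * (Ioc 0 δ).indicator 1 t + ε * (Ioc 0 T).indicator 1 t) := by
        refine weightedNorm_mono fun t ht => ?_
        by_cases htδ : t ≤ δ
        · refine le_trans (rearrangement_le (u := M) ?_) (le_add_right ?_)
          · have : {x | (M : ℝ) < |h x|} = ∅ := eq_empty_of_forall_notMem fun x hx =>
              (hM x).not_gt hx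
            simp [distribution, this]
          · simp [indicator_of_mem (show t ∈ Ioc 0 δ from ⟨ht, htδ⟩)]
        · by_cases htT : t ≤ T
          · refine le_trans (rearrangement_le (hδ.trans
              (ENNReal.ofReal_le_ofReal (not_le.1 htδ).le))) (le_add_left ?_)
            simp [indicator_of_mem (show t ∈ Ioc 0 T from ⟨ht, htT⟩)]
          · refine (rearrangement_le (u := 0) (hT.trans
              (ENNReal.ofReal_le_ofReal (not_le.1 htT).le))).trans ?_
            simp
    _ ≤ _ := weightedNorm_add_le hq ((hmeas δ).const_mul _) ((hmeas T).const_mul _)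
    _ = _ := by
        rw [weightedNorm_const_mul hq (hmeas δ), weightedNorm_const_mul hq (hmeas T)]
        rfl

variable [IsFiniteMeasure μ]

/-- The summand `1` keeps the bound positive when `μ = 0`. -/
lemma distribution_le_ofReal (h : X → ℝ) (s : ℝ≥0) :
    distribution μ h s ≤ ENNReal.ofReal (μ.real univ + 1) :=
  (measure_mono (subset_univ _)).trans ((ENNReal.ofReal_toReal (measure_ne_top μ univ)).ge.trans
    (ENNReal.ofReal_le_ofReal (by rw [Measure.real]; linarith)))

lemma lorentzNorm_lt_top_of_abs_le {p : ℝ} (hp : 0 < p) {q : ℝ≥0∞} (hq : 1 ≤ q) {h : X → ℝ}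
    {M : ℝ≥0} (hM : ∀ x, |h x| ≤ M) : lorentzNorm μ p q h < ⊤ := by
  have hT : 0 < μ.real univ + 1 := by positivity
  refine (lorentzNorm_le_of_abs_le hq hM (distribution_le_ofReal h 0)
    (distribution_le_ofReal h 0)).trans_lt ?_
  have := weightedNormInterval_ne_top hp hq hT
  exact ENNReal.add_lt_top.2 ⟨ENNReal.mul_lt_top ENNReal.coe_lt_top this.lt_top,
    ENNReal.mul_lt_top ENNReal.coe_lt_top this.lt_top⟩

/-- Bounded convergence in Lorentz spaces over a finite measure space. -/
lemma tendsto_lorentzNorm_of_tendsto {p : ℝ} (hp : 0 < p) {q : ℝ≥0∞} (hq : 1 ≤ q)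
    {h : ℕ → X → ℝ} (hm : ∀ n, Measurable (h n)) {M : ℝ≥0} (hM : ∀ n x, |h n x| ≤ M)
    (hlim : ∀ x, Tendsto (fun n => h n x) atTop (𝓝 0)) :
    Tendsto (fun n => lorentzNorm μ p q (h n)) atTop (𝓝 0) := by
  set T := μ.real univ + 1
  have hT : 0 < T := by positivity
  have hb : Tendsto (fun ε : ℝ => (M : ℝ≥0∞) * (ENNReal.ofReal (ε ^ (1 / p)) *
      weightedNormInterval p q 1) + ENNReal.ofReal ε * weightedNormInterval p q T)
      (𝓝[>] 0) (𝓝 0) := by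
    have hpow : Tendsto (fun ε : ℝ => ENNReal.ofReal (ε ^ (1 / p))) (𝓝[>] 0) (𝓝 0) := by
      have : Tendsto (fun ε : ℝ => ε ^ (1 / p)) (𝓝 0) (𝓝 0) := by
        have := (continuous_id (X := ℝ)).tendsto 0 |>.rpow_const (p := 1 / p)
          (.inr (by positivity))
        rwa [id, Real.zero_rpow (by positivity)] at this
      simpa using ENNReal.tendsto_ofReal (this.mono_left nhdsWithin_le_nhds)
    have hid : Tendsto (fun ε : ℝ => ENNReal.ofReal ε) (𝓝[>] 0) (𝓝 0) := by
      simpa using ENNReal.tendsto_ofReal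
        (tendsto_nhdsWithin_of_tendsto_nhds (s := Ioi (0 : ℝ)) (tendsto_id (α := ℝ) (x := 𝓝 0)))
    have h1 := ENNReal.Tendsto.const_mul (a := (M : ℝ≥0∞)) (ENNReal.Tendsto.mul_const hpow
      (.inr (weightedNormInterval_one_ne_top hp hq))) (.inr ENNReal.coe_ne_top)
    have h2 := ENNReal.Tendsto.mul_const hid (.inr (weightedNormInterval_ne_top hp hq hT))
    simpa using h1.add h2
  refine ENNReal.tendsto_nhds_zero.2 fun η hη => ?_
  obtain ⟨ε, hεη, hε⟩ := ((ENNReal.tendsto_nhds_zero.1 hb η hη).and self_mem_nhdsWithin).exists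
  have hε : 0 < ε := hε
  have hmeas := tendstoInMeasure_of_tendsto_ae (μ := μ) (f := h) (g := fun _ => 0)
    (fun n => (hm n).aestronglyMeasurable) (ae_of_all _ hlim)
  filter_upwards [ENNReal.tendsto_nhds_zero.1 (hmeas (ENNReal.ofReal ε) (by simpa using hε))
    (ENNReal.ofReal ε) (by simpa using hε)] with n hn
  have hdist : distribution μ (h n) ε.toNNReal ≤ ENNReal.ofReal ε := by
    refine (measure_mono fun x hx => ?_).trans hn
    have hx : (ε.toNNReal : ℝ) < |h n x| := hx
    rw [Real.coe_toNNReal _ hε.le] at hx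
    rw [mem_ofPred_eq, edist_zero_right, Real.enorm_eq_ofReal_abs]
    exact ENNReal.ofReal_le_ofReal hx.le
  refine (lorentzNorm_le_of_abs_le hq (hM n) hdist (distribution_le_ofReal _ 0)).trans ?_
  rw [weightedNormInterval_eq hq hε]
  exact hεη

end Lorentz

section Bounded

variable {X : Type*} [MetricSpace X] [MeasurableSpace X] {μ : Measure X}

lemma exists_measure_closedBall_two_pow_le {r : ℝ} (hr : 0 < r)
    (hdoubling : ∀ s : ℝ, r ≤ s → IsDoublingAt μ s) (n : ℕ) :
    ∃ Γ : ℝ≥0, 1 ≤ Γ ∧ ∀ x : X,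
      μ (Metric.closedBall x (2 ^ n * r)) ≤ Γ * μ (Metric.closedBall x r) := by
  induction n with
  | zero => exact ⟨1, le_rfl, by simp⟩
  | succ n ih =>
    obtain ⟨Γ, hΓ, h⟩ := ih
    obtain ⟨γ, hγ, h'⟩ := hdoubling (2 ^ n * r)
      (le_mul_of_one_le_left hr.le (one_le_pow₀ one_le_two))
    refine ⟨γ * Γ, one_le_mul hγ hΓ, fun x => ?_⟩
    rw [pow_succ', mul_assoc, ENNReal.coe_mul, mul_assoc]
    exact (h' x).trans (by gcongr; exact h x)

/-- In a bounded space, iterated doubling bounds the measure of the balls of radius `r` from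
below. -/
lemma exists_pos_le_measureReal_closedBall {r : ℝ} (hr : 0 < r)
    (hball : ∀ (x : X) (s : ℝ), 0 < s →
      0 < μ (Metric.closedBall x s) ∧ μ (Metric.closedBall x s) < ⊤)
    (hdoubling : ∀ s : ℝ, r ≤ s → IsDoublingAt μ s)
    (hX : Bornology.IsBounded (univ : Set X)) :
    ∃ m : ℝ, 0 < m ∧ ∀ x : X, m ≤ μ.real (Metric.closedBall x r) := by
  cases isEmpty_or_nonempty X
  · exact ⟨1, one_pos, isEmptyElim⟩
  obtain ⟨R, hR⟩ := Metric.isBounded_iff.1 hX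
  obtain ⟨n, hn⟩ := pow_unbounded_of_one_lt (R / r) one_lt_two
  have huniv : ∀ x : X, Metric.closedBall x (2 ^ n * r) = univ := fun x =>
    eq_univ_of_forall fun y =>
      (hR (mem_univ y) (mem_univ x)).trans ((div_lt_iff₀ hr).1 hn).le
  obtain ⟨Γ, hΓ, h⟩ := exists_measure_closedBall_two_pow_le hr hdoubling n
  have hΓ0 : (0 : ℝ) < Γ := lt_of_lt_of_le one_pos hΓ
  obtain ⟨x₀⟩ := ‹Nonempty X›
  have h0 := hball x₀ (2 ^ n * r) (by positivity)
  rw [huniv] at h0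
  refine ⟨μ.real univ / Γ, div_pos (ENNReal.toReal_pos h0.1.ne' h0.2.ne) hΓ0, fun x => ?_⟩
  rw [div_le_iff₀' hΓ0]
  have hx := h x
  rw [huniv] at hx
  have := ENNReal.toReal_mono (ENNReal.mul_ne_top ENNReal.coe_ne_top (hball x r hr).2.ne) hx
  rwa [ENNReal.toReal_mul] at this

variable [OpensMeasurableSpace X] [SecondCountableTopology X]

/-- On a bounded space the averages of a bounded sequence are uniformly bounded and equicontinuous,
so that a subsequence converges pointwise and boundedly, hence in norm. -/
lemma isCompactOn_averaging_of_isBounded {r : ℝ} (hr : 0 < r)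
    (hball : ∀ (x : X) (s : ℝ), 0 < s →
      0 < μ (Metric.closedBall x s) ∧ μ (Metric.closedBall x s) < ⊤)
    (hdoubling : ∀ s : ℝ, r ≤ s → IsDoublingAt μ s)
    (hcont : ∀ x : X, Tendsto
      (fun y => μ (symmDiff (Metric.closedBall x r) (Metric.closedBall y r))) (𝓝 x) (𝓝 0))
    {p : ℝ} (hp : 1 < p) {q : ℝ≥0∞} (hq : 1 ≤ q)
    (hmaps : MapsTo (averaging μ r) (lorentzSpace μ p q) (lorentzSpace μ p q))
    (hX : Bornology.IsBounded (univ : Set X)) :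
    IsCompactOn (lorentzSpace μ p q) (lorentzNorm μ p q) (averaging μ r) := by
  have hp' : 0 ≤ 1 - 1 / p := by
    rw [sub_nonneg, div_le_one (by linarith)]; exact hp.le
  have hfin : IsFiniteMeasure μ := by
    cases isEmpty_or_nonempty X
    · exact ⟨by simp [univ_eq_empty_iff.2 ‹_›]⟩
    obtain ⟨x₀⟩ := ‹Nonempty X›
    obtain ⟨R, hR0, hR⟩ := hX.subset_closedBall_lt 0 x₀
    exact ⟨(measure_mono hR).trans_lt (hball x₀ R hR0).2⟩
  have hballr := fun x => hball x r hr
  obtain ⟨m, hm, hmle⟩ := exists_pos_le_measureReal_closedBall hr hball hdoubling hX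
  refine ⟨hmaps, fun f hf ⟨C, hC⟩ => ?_⟩
  set K := (integralConst p q * C).toReal
  have hK0 : 0 ≤ K := ENNReal.toReal_nonneg
  have hK : ∀ n, (integralConst p q * lorentzNorm μ p q (f n)).toReal ≤ K := fun n =>
    ENNReal.toReal_mono (ENNReal.mul_ne_top (integralConst_ne_top hp hq) ENNReal.coe_ne_top)
      (by gcongr; exact hC n)
  -- The common bound: `|∫_{B(x,r)} f n| ≤ μ(X)^(1 - 1/p) K` and `m ≤ μ(B(x, r))`.
  set M : ℝ≥0 := (m⁻¹ * (μ.real univ ^ (1 - 1 / p) * K)).toNNReal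
  have hMcoe : (M : ℝ) = m⁻¹ * (μ.real univ ^ (1 - 1 / p) * K) :=
    Real.coe_toNNReal _ (by positivity)
  have hbound : ∀ n x, |averaging μ r (f n) x| ≤ M := by
    intro n x
    rw [hMcoe, averaging, abs_mul, abs_of_nonneg (by positivity)]
    gcongr
    · exact hmle x
    · refine (abs_setIntegral_le hp hq (hf n).1 (hf n).2 (measure_ne_top μ _)).trans ?_
      exact mul_le_mul (Real.rpow_le_rpow measureReal_nonneg (measureReal_mono (subset_univ _)) hp')
        (hK n) ENNReal.toReal_nonneg (by positivity)
  have hmod : ∀ x, ∃ ω : X → ℝ, Tendsto ω (𝓝 x) (𝓝 0) ∧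
      ∀ n y, |averaging μ r (f n) y - averaging μ r (f n) x| ≤ ω y := by
    intro x
    obtain ⟨ω, hω, h⟩ := exists_modulus_averaging hballr hcont hp hq x
    refine ⟨fun y => K * |ω y|, by simpa using hω.abs.const_mul K, fun n y => ?_⟩
    exact (h (f n) (hf n).1 (hf n).2 y).trans
      ((mul_le_mul_of_nonneg_left (le_abs_self _) ENNReal.toReal_nonneg).trans
        (mul_le_mul_of_nonneg_right (hK n) (abs_nonneg _)))
  obtain ⟨g, φ, hφ, hlim⟩ := exists_subseq_tendsto_of_modulus hbound hmod
  have hAm := fun n => (hmaps (hf n)).1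
  have hgm : Measurable g :=
    measurable_of_tendsto_metrizable (fun n => hAm (φ n)) (tendsto_pi_nhds.2 hlim)
  have hgM : ∀ x, |g x| ≤ M := fun x =>
    le_of_tendsto (hlim x).abs (Eventually.of_forall fun n => hbound _ x)
  refine ⟨g, ⟨hgm, lorentzNorm_lt_top_of_abs_le (by linarith) hq hgM⟩, φ, hφ, ?_⟩
  refine tendsto_lorentzNorm_of_tendsto (M := M + M) (by linarith) hq
    (fun n => (hAm (φ n)).sub hgm) (fun n x => ?_) fun x => ?_
  · rw [Pi.sub_apply]
    push_cast
    exact (abs_sub _ _).trans (add_le_add (hbound _ x) (hgM x))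
  · simpa using (hlim x).sub_const (g x)

end Bounded

/-! ### Failure of compactness on unbounded spaces -/

section Lorentz

variable {X : Type*} [MeasurableSpace X] {μ : Measure X}

lemma lorentzNorm_indicator_const_le {p : ℝ} {q : ℝ≥0∞} (hq : 1 ≤ q) {E : Set X} (hE : μ E ≠ ⊤)
    (a : ℝ≥0) :
    lorentzNorm μ p q (E.indicator fun _ => (a : ℝ)) ≤
      a * weightedNormInterval p q (μ.real E) := by
  have hsub : distribution μ (E.indicator fun _ => (a : ℝ)) 0 ≤ ENNReal.ofReal (μ.real E) := by
    rw [Measure.real, ENNReal.ofReal_toReal hE]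
    refine measure_mono fun x hx => ?_
    by_contra hxE
    have hx : (0 : ℝ) < |E.indicator (fun _ => (a : ℝ)) x| := hx
    rw [indicator_of_notMem hxE, abs_zero] at hx
    exact lt_irrefl 0 hx
  have h := lorentzNorm_le_of_abs_le (p := p) hq (ε := 0) (M := a) (fun x => ?_) hsub hsub
  · simpa using h
  · by_cases hx : x ∈ E <;> simp [hx]

/-- As `F*` is at least `a` on `(0, μ E)`, but perhaps not at the endpoint `μ E`, the bound uses the
interval `(0, μ E / 2]`. -/
lemma le_lorentzNorm_of_le_abs {p : ℝ} {q : ℝ≥0∞} (hq : 1 ≤ q) {F : X → ℝ} {E : Set X}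
    (hE : μ E ≠ ⊤) (hE0 : μ E ≠ 0) {a : ℝ≥0} (hF : ∀ x ∈ E, a ≤ |F x|) :
    a * weightedNormInterval p q (μ.real E / 2) ≤ lorentzNorm μ p q F := by
  have hpos : 0 < μ.real E := ENNReal.toReal_pos hE0 hE
  rw [weightedNormInterval,
    ← weightedNorm_const_mul hq (measurable_one.indicator measurableSet_Ioc)]
  refine weightedNorm_mono fun t ht => ?_
  by_cases htE : t ≤ μ.real E / 2
  · rw [indicator_of_mem (show t ∈ Ioc 0 (μ.real E / 2) from ⟨ht, htE⟩), Pi.one_apply, mul_one]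
    refine ENNReal.le_of_forall_nnreal_lt fun u hu => (lt_rearrangement_iff.2 ?_).le
    calc ENNReal.ofReal t < ENNReal.ofReal (μ.real E) :=
          (ENNReal.ofReal_lt_ofReal_iff hpos).2 (by linarith)
      _ = μ E := ENNReal.ofReal_toReal hE
      _ ≤ distribution μ F u := measure_mono fun x hx =>
          lt_of_lt_of_le (NNReal.coe_lt_coe.2 (ENNReal.coe_lt_coe.1 hu)) (hF x hx)
  · simp [indicator, htE]

end Lorentz

section Unbounded

lemma exists_seq_pairwise_lt_dist {X : Type*} [MetricSpace X] [Nonempty X]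
    (hX : ¬ Bornology.IsBounded (univ : Set X)) (R : ℝ) :
    ∃ x : ℕ → X, Pairwise fun m n => R < dist (x m) (x n) := by
  have : Std.Symm fun x y : X => R < dist x y := ⟨fun x y h => by rwa [dist_comm]⟩
  obtain ⟨x, -, hx⟩ := exists_seq_of_forall_finset_exists' (fun _ : X => True)
    (fun x y => R < dist x y) fun s _ => by
      by_contra! h
      obtain ⟨x₀⟩ := ‹Nonempty X›
      refine hX ((Bornology.isBounded_biUnion_finset s).2
        (fun y _ => Metric.isBounded_closedBall (x := y) (r := R)) |>.subset fun y _ => ?_)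
      obtain ⟨z, hz, hzy⟩ := h y trivial
      exact mem_biUnion hz (by rwa [Metric.mem_closedBall'])
  exact ⟨x, hx⟩

variable {X : Type*} [MetricSpace X] [MeasurableSpace X] [OpensMeasurableSpace X] {μ : Measure X}

lemma averaging_indicator_const_of_subset {r : ℝ} {x : X}
    (hball : 0 < μ (Metric.closedBall x r) ∧ μ (Metric.closedBall x r) < ⊤)
    {E : Set X} (hE : Metric.closedBall x r ⊆ E) (a : ℝ) :
    averaging μ r (E.indicator fun _ => a) x = a := by
  have hpos : 0 < μ.real (Metric.closedBall x r) := ENNReal.toReal_pos hball.1.ne' hball.2.ne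
  rw [averaging, setIntegral_congr_fun (g := fun _ => a)
    Metric.isClosed_closedBall.measurableSet (fun y hy => indicator_of_mem (hE hy) _),
    setIntegral_const, smul_eq_mul, inv_mul_cancel_left₀ hpos.ne']

lemma averaging_indicator_const_of_disjoint {r : ℝ} {x : X} {E : Set X}
    (hE : Disjoint (Metric.closedBall x r) E) (a : ℝ) :
    averaging μ r (E.indicator fun _ => a) x = 0 := by
  rw [averaging, setIntegral_congr_fun (g := fun _ => 0)
    Metric.isClosed_closedBall.measurableSet
    (fun y hy => indicator_of_notMem (disjoint_left.1 hE hy) _)]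
  simp

/-- Normalized indicator functions of widely separated balls of radius `2 * r` form a bounded
sequence, but their averages stay at a fixed positive distance from each other. -/
lemma isBounded_of_isCompactOn_averaging {r : ℝ} (hr : 0 < r)
    (hball : ∀ (x : X) (s : ℝ), 0 < s →
      0 < μ (Metric.closedBall x s) ∧ μ (Metric.closedBall x s) < ⊤)
    (hdoubling : IsDoublingAt μ r) {p : ℝ} (hp : 1 < p) {q : ℝ≥0∞} (hq : 1 ≤ q)
    (hT : IsCompactOn (lorentzSpace μ p q) (lorentzNorm μ p q) (averaging μ r)) :
    Bornology.IsBounded (univ : Set X) := by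
  cases isEmpty_or_nonempty X
  · simp [univ_eq_empty_iff.2 ‹_›]
  by_contra hX
  have hp0 : 0 < p := by linarith
  obtain ⟨x, hx⟩ := exists_seq_pairwise_lt_dist hX (6 * r)
  obtain ⟨γ, -, hγ⟩ := hdoubling
  set κ := weightedNormInterval p q 1
  set m : ℕ → ℝ := fun n => μ.real (Metric.closedBall (x n) r)
  have hm : ∀ n, 0 < m n := fun n =>
    ENNReal.toReal_pos (hball (x n) r hr).1.ne' (hball (x n) r hr).2.ne
  -- The factor that normalizes the indicator function of `B(x n, r)`; doubling keeps the norm of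
  -- the indicator function of `B(x n, 2r)` bounded after the same normalization.
  set a : ℕ → ℝ≥0 := fun n => (m n ^ (-(1 / p))).toNNReal
  have ha : ∀ n, (a n : ℝ≥0∞) = ENNReal.ofReal (m n ^ (-(1 / p))) := fun n => rfl
  set f : ℕ → X → ℝ := fun n => (Metric.closedBall (x n) (2 * r)).indicator fun _ => (a n : ℝ)
  have hnorm : ∀ n, lorentzNorm μ p q (f n) ≤ ENNReal.ofReal ((γ : ℝ) ^ (1 / p)) * κ := by
    intro n
    have h2 := hball (x n) (2 * r) (by positivity)
    have h2pos : 0 < μ.real (Metric.closedBall (x n) (2 * r)) := ENNReal.toReal_pos h2.1.ne' h2.2.ne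
    refine (lorentzNorm_indicator_const_le hq h2.2.ne (a n)).trans ?_
    rw [weightedNormInterval_eq hq h2pos, ← mul_assoc, ha, ← ENNReal.ofReal_mul
      (Real.rpow_nonneg (hm n).le _)]
    gcongr
    have hle : μ.real (Metric.closedBall (x n) (2 * r)) ≤ γ * m n := by
      have := ENNReal.toReal_mono
        (ENNReal.mul_ne_top ENNReal.coe_ne_top (hball (x n) r hr).2.ne) (hγ (x n))
      rwa [ENNReal.toReal_mul] at this
    rw [Real.rpow_neg (hm n).le, inv_mul_le_iff₀ (Real.rpow_pos_of_pos (hm n) _),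
      mul_comm (m n ^ _), ← Real.mul_rpow γ.coe_nonneg (hm n).le]
    exact Real.rpow_le_rpow measureReal_nonneg hle (by positivity)
  have hκtop : κ ≠ ⊤ := weightedNormInterval_one_ne_top hp0 hq
  have hCtop : ENNReal.ofReal ((γ : ℝ) ^ (1 / p)) * κ ≠ ⊤ :=
    ENNReal.mul_ne_top ENNReal.ofReal_ne_top hκtop
  obtain ⟨g, -, φ, hφ, hlim⟩ := hT.2 f
    (fun n => ⟨measurable_const.indicator Metric.isClosed_closedBall.measurableSet,
      (hnorm n).trans_lt hCtop.lt_top⟩)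
    ⟨(ENNReal.ofReal ((γ : ℝ) ^ (1 / p)) * κ).toNNReal, fun n => by
      rw [ENNReal.coe_toNNReal hCtop]; exact hnorm n⟩
  set c := ENNReal.ofReal ((1 / 2 : ℝ) ^ (1 / p)) * κ
  have hc : 0 < c := ENNReal.mul_pos (by simp; positivity) (weightedNormInterval_one_ne_zero hq)
  -- On `B(x i, r)` the average of `f i` equals `a i`, while that of `f j` vanishes because the
  -- centres are more than `6 * r` apart.
  have hsep : ∀ i j, i ≠ j → c ≤ lorentzNorm μ p q (averaging μ r (f i) - averaging μ r (f j)) := by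
    intro i j hij
    have hb := hball (x i) r hr
    refine le_trans (le_of_eq ?_) (le_lorentzNorm_of_le_abs hq hb.2.ne hb.1.ne' (a := a i)
      fun y hy => ?_)
    · rw [weightedNormInterval_eq hq (half_pos (hm i)), ← mul_assoc, ha, ← ENNReal.ofReal_mul
        (Real.rpow_nonneg (hm i).le _), div_eq_mul_one_div (m i), Real.mul_rpow (hm i).le
        (by norm_num), ← mul_assoc, ← Real.rpow_add (hm i)]
      simp [c, κ]
    · have hy : dist y (x i) ≤ r := hy
      rw [Pi.sub_apply, averaging_indicator_const_of_subset (hball y r hr)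
          (Metric.closedBall_subset_closedBall' (by linarith)),
        averaging_indicator_const_of_disjoint, sub_zero]
      · exact le_abs_self _
      · refine Metric.closedBall_disjoint_closedBall ?_
        have h1 := hx hij
        have h2 := dist_triangle_left (x i) (x j) y
        linarith
  -- By the quasi-triangle inequality consecutive terms of the convergent subsequence would approach
  -- each other.
  have hcauchy := ENNReal.Tendsto.const_mul (a := ENNReal.ofReal ((1 / 2 : ℝ) ^ (-(1 / p))))
    (hlim.add (hlim.comp (tendsto_add_atTop_nat 1))) (.inr ENNReal.ofReal_ne_top)
  rw [add_zero, mul_zero] at hcauchy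
  refine hc.not_ge (ge_of_tendsto' hcauchy fun n => ?_)
  refine (hsep (φ n) (φ (n + 1)) (hφ (Nat.lt_succ_self n)).ne).trans ?_
  rw [← sub_sub_sub_cancel_right _ _ g]
  exact lorentzNorm_sub_le hq μ _ _

end Unbounded

end AvgOp

theorem corollary1p3 {X : Type*} [MetricSpace X] [MeasurableSpace X] [OpensMeasurableSpace X]
    (μ : Measure X)
    (hball : ∀ (x : X) (s : ℝ), 0 < s →
      0 < μ (Metric.closedBall x s) ∧ μ (Metric.closedBall x s) < ⊤)
    (r : ℝ) (hr : 0 < r)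
    (hdoubling : ∀ s : ℝ, r ≤ s → AvgOp.IsDoublingAt μ s)
    (hvitali : AvgOp.VitaliCoveringProperty μ)
    (hcont : ∀ x : X, Tendsto
      (fun y => μ (symmDiff (Metric.closedBall x r) (Metric.closedBall y r))) (𝓝 x) (𝓝 0))
    (p : ℝ) (hp : 1 < p) (q : ℝ≥0∞) (hq : 1 ≤ q) :
    MapsTo (AvgOp.averaging μ r) (AvgOp.lorentzSpace μ p q) (AvgOp.lorentzSpace μ p q) ∧
    (AvgOp.IsCompactOn (AvgOp.lorentzSpace μ p q) (AvgOp.lorentzNorm μ p q)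
        (AvgOp.averaging μ r) ↔ Bornology.IsBounded (univ : Set X)) ∧
    (AvgOp.IsCompactOn (AvgOp.lorentzSpace μ p q) (AvgOp.lorentzNormMax μ p q)
        (AvgOp.averaging μ r) ↔ Bornology.IsBounded (univ : Set X)) := by
  have : SecondCountableTopology X :=
    AvgOp.secondCountableTopology_of_vitali (fun x s hs => (hball x s hs).1) hvitali
  have : SigmaFinite μ := AvgOp.sigmaFinite_of_closedBall_lt_top fun x => (hball x 1 one_pos).2
  have hmaps := AvgOp.mapsTo_averaging (fun x => hball x r hr) (hdoubling r le_rfl) hcont hp hq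
  have hiff : AvgOp.IsCompactOn (AvgOp.lorentzSpace μ p q) (AvgOp.lorentzNorm μ p q)
      (AvgOp.averaging μ r) ↔ Bornology.IsBounded (univ : Set X) :=
    ⟨AvgOp.isBounded_of_isCompactOn_averaging hr hball (hdoubling r le_rfl) hp hq,
      AvgOp.isCompactOn_averaging_of_isBounded hr hball hdoubling hcont hp hq hmaps⟩
  have hle (f : X → ℝ) : AvgOp.lorentzNorm μ p q f ≤ 1 * AvgOp.lorentzNormMax μ p q f := by
    rw [one_mul]; exact AvgOp.lorentzNorm_le_lorentzNormMax μ p q f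
  have hge := AvgOp.lorentzNormMax_le (p := p) hq μ
  have hC := AvgOp.hardyConst_ne_top hp
  refine ⟨hmaps, hiff, Iff.trans ⟨?_, ?_⟩ hiff⟩
  · exact AvgOp.IsCompactOn.of_equivalent hC ENNReal.one_ne_top hge hle
  · exact AvgOp.IsCompactOn.of_equivalent ENNReal.one_ne_top hC hle hge
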